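/- Let $\Omega=[a,b]\subset\mathbb R$ with $a<b$, let $\Theta\subset\mathbb R^d$ be open, and let $\rho:\Omega\times\Theta\to\mathbb R$ be such that, for every $\theta\in\Theta$, $\rho(\cdot,\theta)$ is a smooth, strictly positive probability density on $\Omega$. Let $F(x,\theta)=\int_a^x\rho(y,\theta)\,dy$ be its cumulative distribution function. For every $x\in\Omega$, let $\rho(x,\cdot)$ be $C^1$ and $F(x,\cdot)$ be $C^2$ on $\Theta$. Let $\rho^*$ be a smooth probability density on $\Omega$. Suppose the following. 1. For every $\theta\in\Theta$ and $\xi\in\mathbb R^d$ the problem $$-\big(\rho(x,\theta)\,\Phi'(x)\big)'=\langle\nabla_\theta\rho(x,\theta),\xi\rangle\quad(x\in\Omega),\qquad \Phi'(a)=\Phi'(b)=0,$$ has a solution $\Phi\in C^\infty(\Omega)$ with $\int_\Omega\rho(x,\theta)\,|\Phi'(x)|^2\,dx<\infty$. 2. Every $\theta_0\in\Theta$ has a neighbourhood $N(\theta_0)\subset\Theta$ such that, for all $1\le i,j\le d$, $$\int_\Omega\sup_{\theta\in N(\theta_0)}\Big|\frac{\partial^2F(x,\theta)}{\partial\theta_i\partial\theta_j}\Big|dx<\infty,\quad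 \int_\Omega\sup_{\theta\in N(\theta_0)}\Big|\frac{\partial\rho(x,\theta)}{\partial\theta_i}\Big|dx<\infty,\quad \int_\Omega\sup_{\theta\in N(\theta_0)}\frac1{\rho(x,\theta)}\Big|\frac{\partial F(x,\theta)}{\partial\theta_i}\frac{\partial F(x,\theta)}{\partial\theta_j}\Big|dx<\infty .$$ 3. For every $\theta\in\Theta$, $T(\cdot,\theta)$ is an optimal transport map from $\rho(\cdot,\theta)\,dx$ to $\rho^*\,dx$ for the cost $|x-y|^2$; it is differentiable in $x$ on $(a,b)$, and its derivative $T'(\cdot,\theta)$ is bounded there (by a constant that may depend on $\theta$). Let $R(\theta)=\frac12W_2(\rho(\cdot,\theta),\rho^*)^2$, where $W_2$ is the $L^2$-Wasserstein distance. Then $R$ is twice differentiable on $\Theta$ and, for every $\theta\in\Theta$, the integrals below converge absolutely and $$\nabla_\theta^2R(\theta)=\int_\Omega\big(T(x,\theta)-x\big)\,\nabla_\theta^2F(x,\theta)\,dx+\int_\Omega\frac{T'(x,\theta)}{\rho(x,\theta)}\,\big(\nabla_\theta F(x,\theta)\big)^{T}\,\nabla_\theta F(x,\theta)\,dx ,$$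 where $\nabla_\theta F$ is regarded as a row vector. -/

import Mathlib

open MeasureTheory Set Topology
open scoped ENNReal ContDiff

namespace WassersteinHessian

noncomputable section

/-! ### Quadratic optimal transport on the real line -/

/-- `π` is a coupling (transport plan) of `μ` and `ν`. -/
def IsCoupling (π : Measure (ℝ × ℝ)) (μ ν : Measure ℝ) : Prop :=
  π.map Prod.fst = μ ∧ π.map Prod.snd = ν

/-- The quadratic transport cost of a transport plan. -/
def planCost (π : Measure (ℝ × ℝ)) : ℝ≥0∞ :=
  ∫⁻ z, ENNReal.ofReal ((z.1 - z.2) ^ 2) ∂π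

/-- The `L²`-Wasserstein distance: the square root of the minimal quadratic cost over all
couplings. -/
def W₂ (μ ν : Measure ℝ) : ℝ :=
  Real.sqrt (⨅ (π : Measure (ℝ × ℝ)) (_ : IsCoupling π μ ν), planCost π).toReal

/-- `S` pushes `μ` forward to `ν`. -/
def IsTransportMap (μ ν : Measure ℝ) (S : ℝ → ℝ) : Prop :=
  AEMeasurable S μ ∧ μ.map S = ν

/-- The quadratic transport cost of a map. -/
def mapCost (μ : Measure ℝ) (S : ℝ → ℝ) : ℝ≥0∞ :=
  ∫⁻ x, ENNReal.ofReal ((x - S x) ^ 2) ∂μ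

/-- `S` is an optimal transport map from `μ` to `ν`: it solves Monge's problem. -/
def IsOptimalTransportMap (μ ν : Measure ℝ) (S : ℝ → ℝ) : Prop :=
  IsTransportMap μ ν S ∧ ∀ S' : ℝ → ℝ, IsTransportMap μ ν S' → mapCost μ S ≤ mapCost μ S'

/-! ### Densities on a compact interval -/

/-- The measure on `ℝ` that has density `f` on `[a, b]` and gives no mass to the complement. -/
def densityMeasure (a b : ℝ) (f : ℝ → ℝ) : Measure ℝ :=
  (volume.restrict (Icc a b)).withDensity fun x => ENNReal.ofReal (f x)

/-- `f` is a smooth probability density on `[a, b]`. -/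
structure IsSmoothDensity (a b : ℝ) (f : ℝ → ℝ) : Prop where
  smooth : ContDiffOn ℝ ∞ f (Icc a b)
  nonneg : ∀ x ∈ Icc a b, 0 ≤ f x
  integral_eq_one : ∫ x in Icc a b, f x = 1

/-! ### Parameter derivatives -/

variable {d : ℕ}

/-- The partial derivative `∂f/∂θ_i` of a function on the parameter space. -/
def pderiv (i : Fin d) (f : EuclideanSpace ℝ (Fin d) → ℝ) (θ : EuclideanSpace ℝ (Fin d)) : ℝ :=
  fderiv ℝ f θ (EuclideanSpace.single i 1)

/-- The Hessian matrix of a function on the parameter space: the matrix of the second Fréchet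
derivative in the standard basis. -/
def hessian (f : EuclideanSpace ℝ (Fin d) → ℝ) (θ : EuclideanSpace ℝ (Fin d)) :
    Matrix (Fin d) (Fin d) ℝ :=
  Matrix.of fun i j =>
    fderiv ℝ (fderiv ℝ f) θ (EuclideanSpace.single i 1) (EuclideanSpace.single j 1)

/-! ### Statistical models -/

/-- The cumulative distribution function `F(x, θ)`, for `x ∈ [a, b]`, of a family of densities on
`[a, b]`. -/
def modelCDF (a : ℝ) (ρ : ℝ → EuclideanSpace ℝ (Fin d) → ℝ) (x : ℝ)
    (θ : EuclideanSpace ℝ (Fin d)) : ℝ :=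
  ∫ y in a..x, ρ y θ

/-- A statistical model with sample space `[a, b]` and parameter space `Θ`: smooth positive
probability densities `ρ(·, θ)`, such that `ρ(x, ·)` is continuously differentiable and the
distribution function `F(x, ·)` is twice continuously differentiable in the parameter. -/
structure IsStatisticalModel (a b : ℝ) (Θ : Set (EuclideanSpace ℝ (Fin d)))
    (ρ : ℝ → EuclideanSpace ℝ (Fin d) → ℝ) : Prop where
  density : ∀ θ ∈ Θ, IsSmoothDensity a b fun x => ρ x θ
  pos : ∀ θ ∈ Θ, ∀ x ∈ Icc a b, 0 < ρ x θ
  contDiffOn_density : ∀ x ∈ Icc a b, ContDiffOn ℝ 1 (ρ x) Θ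
  contDiffOn_cdf : ∀ x ∈ Icc a b, ContDiffOn ℝ 2 (modelCDF a ρ x) Θ

/-- For every parameter `θ` and every tangent vector `ξ`, the elliptic equation
`-(ρ(x, θ) Φ'(x))' = d_ξ ρ(x, θ)` on `[a, b]` with zero Neumann boundary condition has a smooth
solution `Φ` of finite energy. -/
def EllipticAssumption (a b : ℝ) (Θ : Set (EuclideanSpace ℝ (Fin d)))
    (ρ : ℝ → EuclideanSpace ℝ (Fin d) → ℝ) : Prop :=
  ∀ θ ∈ Θ, ∀ ξ : EuclideanSpace ℝ (Fin d), ∃ Φ : ℝ → ℝ,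
    ContDiffOn ℝ ∞ Φ (Icc a b) ∧
    (∀ x ∈ Icc a b,
      -derivWithin (fun y => ρ y θ * derivWithin Φ (Icc a b) y) (Icc a b) x
        = fderiv ℝ (ρ x) θ ξ) ∧
    derivWithin Φ (Icc a b) a = 0 ∧
    derivWithin Φ (Icc a b) b = 0 ∧
    IntegrableOn (fun x => ρ x θ * derivWithin Φ (Icc a b) x ^ 2) (Icc a b)

/-- Local domination: around every parameter there is a neighbourhood over which the suprema of
`|∂²F/∂θ_i∂θ_j|`, of `|∂ρ/∂θ_i|` and of `(1/ρ) |∂F/∂θ_i ∂F/∂θ_j|` have finite integral. -/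
def DominationAssumption (a b : ℝ) (Θ : Set (EuclideanSpace ℝ (Fin d)))
    (ρ : ℝ → EuclideanSpace ℝ (Fin d) → ℝ) : Prop :=
  ∀ θ₀ ∈ Θ, ∃ N ∈ 𝓝 θ₀, N ⊆ Θ ∧ ∀ i j : Fin d,
    (∫⁻ x in Icc a b, ⨆ θ ∈ N,
      ENNReal.ofReal |pderiv i (pderiv j (modelCDF a ρ x)) θ|) < ⊤ ∧
    (∫⁻ x in Icc a b, ⨆ θ ∈ N, ENNReal.ofReal |pderiv i (ρ x) θ|) < ⊤ ∧
    (∫⁻ x in Icc a b, ⨆ θ ∈ N,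
      ENNReal.ofReal (1 / ρ x θ *
        |pderiv i (modelCDF a ρ x) θ * pderiv j (modelCDF a ρ x) θ|)) < ⊤

/-- The Wasserstein loss `R(θ) = ½ W₂(ρ(·, θ), ρ*)²`. -/
def wassersteinLoss (a b : ℝ) (ρ : ℝ → EuclideanSpace ℝ (Fin d) → ℝ) (ρstar : ℝ → ℝ)
    (θ : EuclideanSpace ℝ (Fin d)) : ℝ :=
  1 / 2 * W₂ (densityMeasure a b fun x => ρ x θ) (densityMeasure a b ρstar) ^ 2

end

end WassersteinHessian

open WassersteinHessian

/-!
The loss has a closed form. Let `F(·, θ)` be the distribution function of `ρ(·, θ)`, let `Q` be a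
quantile function of `ρ*`, and let `H` be a primitive of `Q`. Then

  `½ W₂(ρ(·, θ), ρ*)² = const + ∫ (H(F(x, θ)) - x F(x, θ)) dx`,

with a constant that does not depend on `θ` (`half_W₂_sq_eq`), and the Hessian is obtained by
differentiating twice under the integral sign (`hasFDerivAt_integral_primitive`,
`differentiableAt_integral_gradient`):

  `∇R = ∫ (Q(F) - x) ∇F dx`,  `∇²R = ∫ (Q(F) - x) ∇²F dx + ∫ Q'(F) ∇Fᵀ ∇F dx`.

Optimal transport enters in two places. Kantorovich duality, with potentials that are explicit on
the line (`exists_dual_potentials`), shows that the monotone map `Q ∘ F` has the least cost among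
all couplings, and that every optimal map matches the distribution functions almost everywhere.
An optimal map that is continuous on the open interval therefore equals `Q ∘ F` there
(`IsQuantile.comp_cdf_eq_optimal`). Since `F(·, θ)` is a diffeomorphism onto `(0, 1)`, the
differentiability of `T(·, θ)` passes to `Q`, with `Q'(F) = T' / ρ`
(`IsQuantile.hasDerivAt`); in particular `Q'` is bounded. The bound comes from a single parameter
and serves for all of them, as `Q` does not depend on `θ`.

For the domination, `∇²F` has an integrable majorant near every parameter, and `∇F` is uniformly
bounded there because `∇ρ` has an integrable majorant (`IsStatisticalModel.exists_bounds`).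
The suprema in the assumption need not be measurable; by continuity in the parameter they can be
restricted to a countable dense set (`exists_integrable_majorant`).
-/

namespace WassersteinHessian

open ProbabilityTheory Filter

/-! ### Distribution functions of atomless measures on an interval -/

section CDF

variable {a b : ℝ} {μ ν : Measure ℝ}

theorem continuous_cdf (ν : Measure ℝ) [IsProbabilityMeasure ν] [NullSingletonClass ν] :
    Continuous (cdf ν) := by
  refine continuous_iff_continuousAt.2 fun x => ?_
  rw [(monotone_cdf ν).continuousAt_iff_leftLim_eq_rightLim, (cdf ν).rightLim_eq]
  have h := (cdf ν).measure_singleton x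
  rw [measure_cdf, measure_singleton] at h
  have h2 := ENNReal.ofReal_eq_zero.1 h.symm
  exact le_antisymm ((monotone_cdf ν).leftLim_le le_rfl) (by linarith)

theorem cdf_left_eq_zero [IsProbabilityMeasure ν] [NullSingletonClass ν] (hν : ν (Icc a b)ᶜ = 0) :
    cdf ν a = 0 := by
  rw [cdf_eq_real, measureReal_def, measure_mono_null (t := (Icc a b)ᶜ ∪ {a}), ENNReal.toReal_zero]
  · intro x hx
    by_cases h : x = a
    · exact Or.inr h
    · exact Or.inl fun h2 => h (le_antisymm hx h2.1)
  · rw [measure_union_null_iff]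
    exact ⟨hν, measure_singleton a⟩

theorem cdf_right_eq_one [IsProbabilityMeasure ν] (hν : ν (Icc a b)ᶜ = 0) :
    cdf ν b = 1 := by
  rw [cdf_eq_real, measureReal_def, (prob_compl_eq_zero_iff measurableSet_Iic).1
    (measure_mono_null _ hν), ENNReal.toReal_one]
  intro x hx h
  exact hx h.2

theorem exists_cdf_eq [IsProbabilityMeasure ν] [NullSingletonClass ν] (hab : a ≤ b)
    (hν : ν (Icc a b)ᶜ = 0) {u : ℝ} (hu : u ∈ Icc (0 : ℝ) 1) : ∃ y ∈ Icc a b, cdf ν y = u := by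
  have h := intermediate_value_Icc hab (continuous_cdf ν).continuousOn
  rw [cdf_left_eq_zero hν, cdf_right_eq_one hν] at h
  exact h hu

theorem cdf_mem_Icc (μ : Measure ℝ) (x : ℝ) : cdf μ x ∈ Icc (0 : ℝ) 1 :=
  ⟨cdf_nonneg μ x, cdf_le_one μ x⟩

/-- A map that matches the distribution functions pushes `μ` forward to `ν`. -/
theorem map_eq_of_cdf_comp_eq [IsProbabilityMeasure μ] [NullSingletonClass μ]
    [IsProbabilityMeasure ν] (hab : a ≤ b) (hμ : μ (Icc a b)ᶜ = 0)
    (hF : StrictMonoOn (cdf μ) (Icc a b)) {S : ℝ → ℝ} (hS : AEMeasurable S μ)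
    (h : ∀ᵐ x ∂μ, cdf ν (S x) = cdf μ x) : μ.map S = ν := by
  have := Measure.isProbabilityMeasure_map hS
  refine Measure.ext_of_Iic _ _ fun y => ?_
  -- Up to null sets, `{S ≤ y} = {x ≤ r}` for the point `r` with `cdf μ r = cdf ν y`.
  obtain ⟨r, hr, hry⟩ := exists_cdf_eq hab hμ (cdf_mem_Icc ν y)
  rw [Measure.map_apply_of_aemeasurable hS measurableSet_Iic, ← ofReal_cdf, ← hry, ofReal_cdf]
  refine measure_congr ?_
  have h1 : ∀ᵐ x ∂μ, x ∈ Icc a b := hμ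
  have h2 : ∀ᵐ x ∂μ, x ≠ r := by
    simp [ae_iff]
  filter_upwards [h, h1, h2] with x hx hxI hxr
  refine propext (show S x ≤ y ↔ x ≤ r from ⟨fun hle => ?_, fun hle => ?_⟩)
  · by_contra! hlt
    have := hF hr hxI hlt
    have := monotone_cdf ν hle
    linarith
  · by_contra! hlt
    have := hF hxI hr (lt_of_le_of_ne hle hxr)
    have := monotone_cdf ν hlt.le
    linarith

end CDF

/-! ### Duality for the quadratic cost on the line -/

section Duality

variable {a b : ℝ} {μ ν : Measure ℝ}

/-- Kantorovich potentials of the monotone map `S` that matches the distribution functions: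
with `φ = ∫ S` and its Legendre transform `ψ`, the gap `φ(x) + ψ(y) - x y` is the integral of
`S - y` from the point `r` with `cdf μ r = cdf ν y` to `x`, hence nonnegative, and it vanishes only
for `x = r`. -/
theorem exists_dual_potentials [IsProbabilityMeasure μ] [NullSingletonClass μ]
    (hab : a ≤ b) (hμ : μ (Icc a b)ᶜ = 0) (hF : StrictMonoOn (cdf μ) (Icc a b))
    {S : ℝ → ℝ} (hSm : Monotone S) (hS : ∀ x, cdf ν (S x) = cdf μ x) :
    ∃ A B : ℝ → ℝ, Measurable A ∧ Measurable B ∧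
      (∃ C, ∀ x ∈ Icc a b, |A x| ≤ C ∧ |B x| ≤ C) ∧
      ∀ x ∈ Icc a b, ∀ y, A x + B y ≤ (x - y) ^ 2 ∧
        ((x - y) ^ 2 = A x + B y ↔ cdf ν y = cdf μ x) := by
  choose R hRI hR using fun y => exists_cdf_eq hab hμ (cdf_mem_Icc ν y)
  have hRm : Monotone R := fun y y' h => by
    rw [← hF.le_iff_le (hRI y) (hRI y'), hR, hR]
    exact monotone_cdf ν h
  have hSi : ∀ u v, IntervalIntegrable S volume u v := fun u v => hSm.intervalIntegrable
  have hφ : Continuous fun x => ∫ t in a..x, S t := intervalIntegral.continuous_primitive hSi a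
  -- `S` crosses the level `y` at `R y`, strictly from below to above.
  have hright : ∀ y, ∀ t ∈ Icc a b, R y < t → y < S t := fun y t ht hlt => by
    by_contra! hle
    have h1 := hF (hRI y) ht hlt
    have h2 := monotone_cdf ν hle
    rw [hS] at h2
    rw [hR] at h1
    linarith
  have hleft : ∀ y, ∀ t ∈ Icc a b, t < R y → S t < y := fun y t ht hlt => by
    by_contra! hle
    have h1 := hF ht (hRI y) hlt
    have h2 := monotone_cdf ν hle
    rw [hS] at h2
    rw [hR] at h1
    linarith
  have hgap : ∀ x ∈ Icc a b, ∀ y, x ≠ R y → 0 < ∫ t in (R y)..x, (S t - y) := by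
    intro x hx y hne
    rcases lt_or_gt_of_ne hne with hlt | hlt
    · rw [intervalIntegral.integral_symm, ← intervalIntegral.integral_neg]
      refine intervalIntegral.intervalIntegral_pos_of_pos_on
        ((hSi _ _).sub intervalIntegrable_const).neg (fun t ht => ?_) hlt
      have := hleft y t ⟨hx.1.trans ht.1.le, ht.2.le.trans (hRI y).2⟩ ht.2
      linarith
    · refine intervalIntegral.intervalIntegral_pos_of_pos_on
        ((hSi _ _).sub intervalIntegrable_const) (fun t ht => ?_) hlt
      have := hright y t ⟨(hRI y).1.trans ht.1.le, ht.2.le.trans hx.2⟩ ht.1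
      linarith
  have hval : ∀ x y, ∫ t in (R y)..x, (S t - y)
      = (∫ t in a..x, S t) - (∫ t in a..(R y), S t) - y * (x - R y) := by
    intro x y
    rw [intervalIntegral.integral_sub (hSi _ _) intervalIntegrable_const,
      intervalIntegral.integral_const, smul_eq_mul,
      ← intervalIntegral.integral_interval_sub_left (hSi a x) (hSi a (R y))]
    ring
  obtain ⟨C, hC⟩ := isCompact_Icc.exists_bound_of_continuousOn (s := Icc a b) hφ.continuousOn
  refine ⟨fun x => x ^ 2 - 2 * ∫ t in a..x, S t,
    fun y => y ^ 2 - 2 * (y * R y - ∫ t in a..(R y), S t), by fun_prop,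
    ?_, ⟨(|a| + |b|) ^ 2 + 2 * ((|a| + |b|) * (|a| + |b|) + C), fun x hx => ?_⟩,
    fun x hx y => ⟨?_, ?_⟩⟩
  · have h1 := hRm.measurable
    have h2 := hφ.measurable.comp h1
    exact (measurable_id.pow_const 2).sub (((measurable_id.mul h1).sub h2).const_mul 2)
  · have key : ∀ z ∈ Icc a b, |z| ≤ |a| + |b| := fun z hz => by
      rw [abs_le]
      constructor
      · linarith [hz.1, neg_abs_le a, abs_nonneg b]
      · linarith [hz.2, le_abs_self b, abs_nonneg a]
    have hx1 := key x hx
    have hR1 := key (R x) (hRI x)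
    have h1 := hC x hx
    have h2 := hC (R x) (hRI x)
    rw [Real.norm_eq_abs] at h1 h2
    have hsq : |x ^ 2| ≤ (|a| + |b|) ^ 2 := by
      rw [abs_pow]
      exact pow_le_pow_left₀ (abs_nonneg _) hx1 2
    have hxR : |x * R x| ≤ (|a| + |b|) * (|a| + |b|) := by
      rw [abs_mul]
      exact mul_le_mul hx1 hR1 (abs_nonneg _) (by positivity)
    have hnn : 0 ≤ (|a| + |b|) * (|a| + |b|) := by positivity
    rw [abs_le] at h1 h2 hsq hxR
    constructor <;> rw [abs_le] <;> constructor <;> dsimp only <;>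
      linarith [h1.1, h1.2, h2.1, h2.2, hsq.1, hsq.2, hxR.1, hxR.2]
  · have h0 : 0 ≤ ∫ t in (R y)..x, (S t - y) := by
      by_cases h : x = R y
      · rw [h, intervalIntegral.integral_same]
      · exact (hgap x hx y h).le
    rw [hval] at h0
    dsimp only
    nlinarith [h0]
  · dsimp only
    constructor
    · intro h
      by_cases hxR : x = R y
      · rw [hxR, hR]
      · have h0 := hgap x hx y hxR
        rw [hval] at h0
        nlinarith [h0]
    · intro h
      have hxR : x = R y := hF.injOn hx (hRI y) (by rw [hR, h])
      rw [← hxR]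
      ring

theorem integrable_of_bounded_on_Icc [IsFiniteMeasure μ] (hμ : μ (Icc a b)ᶜ = 0) {A : ℝ → ℝ}
    (hA : AEMeasurable A μ) {C : ℝ} (hC : ∀ x ∈ Icc a b, |A x| ≤ C) : Integrable A μ := by
  refine Integrable.of_bound hA.aestronglyMeasurable C ?_
  have h1 : ∀ᵐ x ∂μ, x ∈ Icc a b := hμ
  filter_upwards [h1] with x hx using hC x hx

/-- Every plan costs at least as much as the monotone map `S` that matches the distribution
functions, with equality only for plans concentrated on the set where these functions agree. -/
theorem le_planCost [IsProbabilityMeasure μ] [NullSingletonClass μ] [IsProbabilityMeasure ν]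
    (hab : a ≤ b) (hμ : μ (Icc a b)ᶜ = 0) (hν : ν (Icc a b)ᶜ = 0)
    (hF : StrictMonoOn (cdf μ) (Icc a b))
    {S : ℝ → ℝ} (hSm : Monotone S) (hS : ∀ x, cdf ν (S x) = cdf μ x)
    {π : Measure (ℝ × ℝ)} (hπ : IsCoupling π μ ν) :
    ENNReal.ofReal (∫ x, (x - S x) ^ 2 ∂μ) ≤ planCost π ∧
      (planCost π ≤ ENNReal.ofReal (∫ x, (x - S x) ^ 2 ∂μ) →
        ∀ᵐ z ∂π, cdf ν z.2 = cdf μ z.1) := by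
  obtain ⟨A, B, hAm, hBm, ⟨C, hC⟩, hAB⟩ := exists_dual_potentials hab hμ hF hSm hS
  have hmap : μ.map S = ν :=
    map_eq_of_cdf_comp_eq hab hμ hF hSm.measurable.aemeasurable (Eventually.of_forall hS)
  have hAi := integrable_of_bounded_on_Icc hμ hAm.aemeasurable fun x hx => (hC x hx).1
  have hBi := integrable_of_bounded_on_Icc hν hBm.aemeasurable fun x hx => (hC x hx).2
  have hμI : ∀ᵐ x ∂μ, x ∈ Icc a b := hμ
  have hνI : ∀ᵐ x ∂ν, x ∈ Icc a b := hν
  have hSval : ∫ x, (x - S x) ^ 2 ∂μ = ∫ x, A x ∂μ + ∫ y, B y ∂ν := by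
    rw [← hmap, integral_map hSm.measurable.aemeasurable hBm.aestronglyMeasurable,
      ← integral_add hAi]
    · refine integral_congr_ae ?_
      filter_upwards [hμI] with x hx
      exact (hAB x hx (S x)).2.2 (hS x)
    · refine Integrable.comp_measurable ?_ hSm.measurable
      rwa [hmap]
  have : IsProbabilityMeasure π := by
    constructor
    have h := measure_univ (μ := μ)
    rwa [← hπ.1, Measure.map_apply measurable_fst MeasurableSet.univ, preimage_univ] at h
  have h1 : ∀ᵐ z ∂π, z.1 ∈ Icc a b :=
    ae_of_ae_map measurable_fst.aemeasurable (by rw [hπ.1]; exact hμI)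
  have h2 : ∀ᵐ z ∂π, z.2 ∈ Icc a b :=
    ae_of_ae_map measurable_snd.aemeasurable (by rw [hπ.2]; exact hνI)
  have hAπ : Integrable (fun z : ℝ × ℝ => A z.1) π :=
    Integrable.comp_measurable (f := Prod.fst) (by rwa [hπ.1]) measurable_fst
  have hBπ : Integrable (fun z : ℝ × ℝ => B z.2) π :=
    Integrable.comp_measurable (f := Prod.snd) (by rwa [hπ.2]) measurable_snd
  have hABπ : Integrable (fun z : ℝ × ℝ => A z.1 + B z.2) π := hAπ.add hBπ
  have hc : Integrable (fun z : ℝ × ℝ => (z.1 - z.2) ^ 2) π := by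
    refine Integrable.of_bound (by fun_prop) ((b - a) ^ 2) ?_
    filter_upwards [h1, h2] with z hz1 hz2
    rw [Real.norm_eq_abs, abs_pow]
    refine pow_le_pow_left₀ (abs_nonneg _) ?_ 2
    rw [abs_le]
    constructor <;> linarith [hz1.1, hz1.2, hz2.1, hz2.2]
  have hplan : planCost π = ENNReal.ofReal (∫ z, (z.1 - z.2) ^ 2 ∂π) :=
    (ofReal_integral_eq_lintegral_ofReal hc (Eventually.of_forall fun z => sq_nonneg _)).symm
  have hAv : ∫ z, A z.1 ∂π = ∫ x, A x ∂μ := by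
    conv_rhs => rw [← hπ.1]
    exact (integral_map measurable_fst.aemeasurable hAm.aestronglyMeasurable).symm
  have hBv : ∫ z, B z.2 ∂π = ∫ x, B x ∂ν := by
    conv_rhs => rw [← hπ.2]
    exact (integral_map measurable_snd.aemeasurable hBm.aestronglyMeasurable).symm
  -- The excess of the cost over the sum of the potentials is nonnegative, and its integral is the
  -- excess of the cost of `π` over that of `S`.
  have hgapnn : 0 ≤ᵐ[π] fun z : ℝ × ℝ => (z.1 - z.2) ^ 2 - (A z.1 + B z.2) := by
    filter_upwards [h1] with z hz
    exact sub_nonneg.2 (hAB z.1 hz z.2).1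
  have hgap : ∫ z, ((z.1 - z.2) ^ 2 - (A z.1 + B z.2)) ∂π
      = ∫ z, (z.1 - z.2) ^ 2 ∂π - ∫ x, (x - S x) ^ 2 ∂μ := by
    rw [integral_sub hc hABπ, integral_add hAπ hBπ, hAv, hBv, hSval]
  have hle : ∫ x, (x - S x) ^ 2 ∂μ ≤ ∫ z, (z.1 - z.2) ^ 2 ∂π := by
    have := integral_nonneg_of_ae hgapnn
    linarith
  refine ⟨hplan ▸ ENNReal.ofReal_le_ofReal hle, fun hle2 => ?_⟩
  rw [hplan, ENNReal.ofReal_le_ofReal_iff (integral_nonneg fun x => sq_nonneg _)] at hle2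
  have h0 : ∫ z, ((z.1 - z.2) ^ 2 - (A z.1 + B z.2)) ∂π = 0 := by linarith
  have := (integral_eq_zero_iff_of_nonneg_ae hgapnn (hc.sub hABπ)).1 h0
  filter_upwards [this, h1] with z hz hz1
  exact (hAB z.1 hz1 z.2).2.1 (sub_eq_zero.1 hz)

theorem isCoupling_map_prodMk {T : ℝ → ℝ} (hT : IsTransportMap μ ν T) :
    IsCoupling (μ.map fun x => (x, T x)) μ ν := by
  have h : AEMeasurable (fun x => (x, T x)) μ := aemeasurable_id.prodMk hT.1
  constructor
  · rw [AEMeasurable.map_map_of_aemeasurable measurable_fst.aemeasurable h]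
    exact Measure.map_id
  · rw [AEMeasurable.map_map_of_aemeasurable measurable_snd.aemeasurable h]
    exact hT.2

theorem planCost_map_prodMk {T : ℝ → ℝ} (hT : AEMeasurable T μ) :
    planCost (μ.map fun x => (x, T x)) = mapCost μ T :=
  lintegral_map' (by fun_prop) (aemeasurable_id.prodMk hT)

theorem mapCost_eq_ofReal_integral [IsFiniteMeasure μ] (hμ : μ (Icc a b)ᶜ = 0)
    {S : ℝ → ℝ} (hSm : Measurable S) (hSI : ∀ x, S x ∈ Icc a b) :
    mapCost μ S = ENNReal.ofReal (∫ x, (x - S x) ^ 2 ∂μ) := by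
  refine (ofReal_integral_eq_lintegral_ofReal ?_ (Eventually.of_forall fun z => sq_nonneg _)).symm
  refine integrable_of_bounded_on_Icc (C := (b - a) ^ 2) hμ (by fun_prop) fun x hx => ?_
  rw [abs_pow]
  refine pow_le_pow_left₀ (abs_nonneg _) ?_ 2
  rw [abs_le]
  constructor <;> linarith [hx.1, hx.2, (hSI x).1, (hSI x).2]

/-- The squared Wasserstein distance is the cost of the monotone map. -/
theorem W₂_sq_eq_integral [IsProbabilityMeasure μ] [NullSingletonClass μ] [IsProbabilityMeasure ν]
    (hab : a ≤ b) (hμ : μ (Icc a b)ᶜ = 0) (hν : ν (Icc a b)ᶜ = 0)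
    (hF : StrictMonoOn (cdf μ) (Icc a b))
    {S : ℝ → ℝ} (hSm : Monotone S) (hSI : ∀ x, S x ∈ Icc a b)
    (hS : ∀ x, cdf ν (S x) = cdf μ x) :
    W₂ μ ν ^ 2 = ∫ x, (x - S x) ^ 2 ∂μ := by
  have hST : IsTransportMap μ ν S := ⟨hSm.measurable.aemeasurable,
    map_eq_of_cdf_comp_eq hab hμ hF hSm.measurable.aemeasurable (Eventually.of_forall hS)⟩
  have hinf : (⨅ (π : Measure (ℝ × ℝ)) (_ : IsCoupling π μ ν), planCost π)
      = ENNReal.ofReal (∫ x, (x - S x) ^ 2 ∂μ) := by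
    refine le_antisymm ?_ (le_iInf₂ fun π hπ => (le_planCost hab hμ hν hF hSm hS hπ).1)
    refine (iInf₂_le (f := fun (π : Measure (ℝ × ℝ)) (_ : IsCoupling π μ ν) => planCost π) _
      (isCoupling_map_prodMk hST)).trans_eq ?_
    rw [planCost_map_prodMk hST.1, mapCost_eq_ofReal_integral hμ hSm.measurable hSI]
  rw [W₂, Real.sq_sqrt ENNReal.toReal_nonneg, hinf,
    ENNReal.toReal_ofReal (integral_nonneg fun x => sq_nonneg _)]

/-- An optimal map matches the distribution functions. -/
theorem IsOptimalTransportMap.cdf_comp_ae_eq [IsProbabilityMeasure μ] [NullSingletonClass μ]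
    [IsProbabilityMeasure ν]
    (hab : a ≤ b) (hμ : μ (Icc a b)ᶜ = 0) (hν : ν (Icc a b)ᶜ = 0)
    (hF : StrictMonoOn (cdf μ) (Icc a b))
    {S : ℝ → ℝ} (hSm : Monotone S) (hSI : ∀ x, S x ∈ Icc a b)
    (hS : ∀ x, cdf ν (S x) = cdf μ x) {T : ℝ → ℝ} (hT : IsOptimalTransportMap μ ν T) :
    ∀ᵐ x ∂μ, cdf ν (T x) = cdf μ x := by
  have hST : IsTransportMap μ ν S := ⟨hSm.measurable.aemeasurable,
    map_eq_of_cdf_comp_eq hab hμ hF hSm.measurable.aemeasurable (Eventually.of_forall hS)⟩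
  refine ae_of_ae_map (f := fun x => (x, T x)) (aemeasurable_id.prodMk hT.1.1)
    ((le_planCost hab hμ hν hF hSm hS (isCoupling_map_prodMk hT.1)).2 ?_)
  rw [planCost_map_prodMk hT.1.1, ← mapCost_eq_ofReal_integral hμ hSm.measurable hSI]
  exact hT.2 S hST

end Duality

/-! ### Measures with a smooth density on an interval -/

section Density

variable {a b : ℝ} {f : ℝ → ℝ}

instance nullSingletonClass_densityMeasure (a b : ℝ) (f : ℝ → ℝ) :
    NullSingletonClass (densityMeasure a b f) := by
  unfold densityMeasure
  infer_instance

theorem densityMeasure_compl_Icc (a b : ℝ) (f : ℝ → ℝ) :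
    densityMeasure a b f (Icc a b)ᶜ = 0 := by
  refine withDensity_absolutelyContinuous _ _ ?_
  rw [Measure.restrict_apply measurableSet_Icc.compl, compl_inter_self, measure_empty]

namespace IsSmoothDensity

theorem integrableOn (hf : IsSmoothDensity a b f) : IntegrableOn f (Icc a b) :=
  hf.smooth.continuousOn.integrableOn_compact isCompact_Icc

theorem isProbabilityMeasure (hf : IsSmoothDensity a b f) :
    IsProbabilityMeasure (densityMeasure a b f) := by
  constructor
  rw [densityMeasure, withDensity_apply _ MeasurableSet.univ, Measure.restrict_univ,
    ← ofReal_integral_eq_lintegral_ofReal hf.integrableOn, hf.integral_eq_one, ENNReal.ofReal_one]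
  exact (ae_restrict_iff' measurableSet_Icc).2 (Eventually.of_forall hf.nonneg)

theorem intervalIntegrable (hf : IsSmoothDensity a b f) {x y : ℝ} (hx : x ∈ Icc a b)
    (hy : y ∈ Icc a b) : IntervalIntegrable f volume x y :=
  (hf.smooth.continuousOn.mono (uIcc_subset_Icc hx hy)).intervalIntegrable

theorem cdf_eq (hf : IsSmoothDensity a b f) {x : ℝ} (hx : x ∈ Icc a b) :
    cdf (densityMeasure a b f) x = ∫ y in a..x, f y := by
  have := hf.isProbabilityMeasure
  have hsub : Icc a x ⊆ Icc a b := Icc_subset_Icc_right hx.2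
  have hI : Iic x ∩ Icc a b = Icc a x := by
    ext t
    simp only [mem_inter_iff, mem_Iic, mem_Icc]
    constructor
    · rintro ⟨h1, h2, -⟩
      exact ⟨h2, h1⟩
    · rintro ⟨h1, h2⟩
      exact ⟨h2, h1, h2.trans hx.2⟩
  rw [cdf_eq_real, measureReal_def, densityMeasure, withDensity_apply _ measurableSet_Iic,
    Measure.restrict_restrict measurableSet_Iic, hI,
    ← ofReal_integral_eq_lintegral_ofReal (hf.integrableOn.mono_set hsub),
    intervalIntegral.integral_of_le hx.1, ← integral_Icc_eq_integral_Ioc, ENNReal.toReal_ofReal]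
  · exact setIntegral_nonneg measurableSet_Icc fun t ht => hf.nonneg t (hsub ht)
  · exact (ae_restrict_iff' measurableSet_Icc).2
      (Eventually.of_forall fun t ht => hf.nonneg t (hsub ht))

theorem strictMonoOn_cdf (hf : IsSmoothDensity a b f) (hpos : ∀ x ∈ Icc a b, 0 < f x) :
    StrictMonoOn (cdf (densityMeasure a b f)) (Icc a b) := by
  intro x hx y hy hxy
  have ha : a ∈ Icc a b := ⟨le_rfl, hx.1.trans hx.2⟩
  rw [hf.cdf_eq hx, hf.cdf_eq hy, ← sub_pos, intervalIntegral.integral_interval_sub_left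
    (hf.intervalIntegrable ha hy) (hf.intervalIntegrable ha hx)]
  exact intervalIntegral.intervalIntegral_pos_of_pos_on (hf.intervalIntegrable hx hy)
    (fun t ht => hpos t ⟨hx.1.trans ht.1.le, ht.2.le.trans hy.2⟩) hxy

theorem hasStrictDerivAt_cdf (hf : IsSmoothDensity a b f) {x : ℝ} (hx : x ∈ Ioo a b) :
    HasStrictDerivAt (cdf (densityMeasure a b f)) (f x) x := by
  have hc : ContinuousOn f (Ioo a b) := hf.smooth.continuousOn.mono Ioo_subset_Icc_self
  have h := intervalIntegral.integral_hasStrictDerivAt_right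
    (hf.intervalIntegrable ⟨le_rfl, (hx.1.trans hx.2).le⟩ (Ioo_subset_Icc_self hx))
    (hc.stronglyMeasurableAtFilter isOpen_Ioo x hx) (hc.continuousAt (isOpen_Ioo.mem_nhds hx))
  refine h.congr_of_eventuallyEq ?_
  filter_upwards [isOpen_Ioo.mem_nhds hx] with t ht
  exact (hf.cdf_eq (Ioo_subset_Icc_self ht)).symm

theorem cdf_mem_Ioo (hf : IsSmoothDensity a b f) (hpos : ∀ x ∈ Icc a b, 0 < f x) {x : ℝ}
    (hx : x ∈ Ioo a b) : cdf (densityMeasure a b f) x ∈ Ioo (0 : ℝ) 1 := by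
  have := hf.isProbabilityMeasure
  have hab := hx.1.trans hx.2
  have hm := hf.strictMonoOn_cdf hpos
  rw [← cdf_left_eq_zero (densityMeasure_compl_Icc a b f),
    ← cdf_right_eq_one (densityMeasure_compl_Icc a b f)]
  exact ⟨hm ⟨le_rfl, hab.le⟩ (Ioo_subset_Icc_self hx) hx.1,
    hm (Ioo_subset_Icc_self hx) ⟨hab.le, le_rfl⟩ hx.2⟩

theorem exists_cdf_eq_of_mem_Ioo (hf : IsSmoothDensity a b f) (hab : a < b) {u : ℝ}
    (hu : u ∈ Ioo (0 : ℝ) 1) : ∃ x ∈ Ioo a b, cdf (densityMeasure a b f) x = u := by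
  have := hf.isProbabilityMeasure
  have hI := densityMeasure_compl_Icc a b f
  obtain ⟨x, hx, hxu⟩ := exists_cdf_eq hab.le hI (Ioo_subset_Icc_self hu)
  refine ⟨x, ⟨lt_of_le_of_ne hx.1 fun h => ?_, lt_of_le_of_ne hx.2 fun h => ?_⟩, hxu⟩
  · rw [← h, cdf_left_eq_zero hI] at hxu
    exact hu.1.ne hxu
  · rw [h, cdf_right_eq_one hI] at hxu
    exact hu.2.ne hxu.symm

theorem integral_densityMeasure (hf : IsSmoothDensity a b f) (g : ℝ → ℝ) :
    ∫ x, g x ∂densityMeasure a b f = ∫ x in Icc a b, f x * g x := by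
  rw [densityMeasure, integral_withDensity_eq_integral_toReal_smul₀]
  · refine setIntegral_congr_fun measurableSet_Icc fun x hx => ?_
    simp only [smul_eq_mul, ENNReal.toReal_ofReal (hf.nonneg x hx)]
  · exact (hf.integrableOn.aestronglyMeasurable.aemeasurable).ennreal_ofReal
  · exact Eventually.of_forall fun x => ENNReal.ofReal_lt_top

theorem ae_restrict_of_ae (hf : IsSmoothDensity a b f) (hpos : ∀ x ∈ Icc a b, 0 < f x)
    {p : ℝ → Prop} (h : ∀ᵐ x ∂densityMeasure a b f, p x) :
    ∀ᵐ x ∂volume.restrict (Icc a b), p x := by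
  rw [densityMeasure,
    ae_withDensity_iff' (hf.integrableOn.aestronglyMeasurable.aemeasurable.ennreal_ofReal)] at h
  filter_upwards [h, ae_restrict_mem measurableSet_Icc] with x hx hxI
  exact hx (ENNReal.ofReal_pos.2 (hpos x hxI)).ne'

end IsSmoothDensity

end Density

/-! ### The quantile function of the target and the transport map -/

section Quantile

variable {a b : ℝ} {f : ℝ → ℝ} {ν : Measure ℝ} {Q : ℝ → ℝ}

/-- `Q` is a quantile function of `ν`: a right inverse of the distribution function, with values
in `[a, b]`. On the flat parts of the distribution function the choice of the value is free. -/
def IsQuantile (a b : ℝ) (ν : Measure ℝ) (Q : ℝ → ℝ) : Prop :=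
  ∀ u ∈ Icc (0 : ℝ) 1, Q u ∈ Icc a b ∧ cdf ν (Q u) = u

theorem exists_isQuantile [IsProbabilityMeasure ν] [NullSingletonClass ν] (hab : a ≤ b)
    (hν : ν (Icc a b)ᶜ = 0) : ∃ Q, IsQuantile a b ν Q := by
  choose! Q hQ using fun u (hu : u ∈ Icc (0 : ℝ) 1) => exists_cdf_eq hab hν hu
  exact ⟨Q, hQ⟩

namespace IsQuantile

theorem monotoneOn (hQ : IsQuantile a b ν Q) : MonotoneOn Q (Icc 0 1) := by
  intro u hu v hv huv
  by_contra! hlt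
  have h := monotone_cdf ν hlt.le
  rw [(hQ u hu).2, (hQ v hv).2] at h
  rw [le_antisymm huv h] at hlt
  exact lt_irrefl _ hlt

theorem monotone_comp_cdf (hQ : IsQuantile a b ν Q) (μ : Measure ℝ) :
    Monotone fun x => Q (cdf μ x) := fun _ _ h =>
  hQ.monotoneOn (cdf_mem_Icc μ _) (cdf_mem_Icc μ _) (monotone_cdf μ h)

/-- A continuous map that matches the distribution functions is the composition of the quantile
function of the target with the distribution function of the source. -/
theorem comp_cdf_eq (hQ : IsQuantile a b ν Q) {F T : ℝ → ℝ} (hF : StrictMonoOn F (Icc a b))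
    (hF01 : ∀ x ∈ Ioo a b, F x ∈ Icc (0 : ℝ) 1) (hT : ContinuousOn T (Ioo a b))
    (h : ∀ x ∈ Ioo a b, cdf ν (T x) = F x) {x : ℝ} (hx : x ∈ Ioo a b) : Q (F x) = T x := by
  have hxI := Ioo_subset_Icc_self hx
  have hTx := hT.continuousAt (isOpen_Ioo.mem_nhds hx)
  have hQx := (hQ _ (hF01 x hx)).2
  refine le_antisymm (not_lt.1 fun hlt => ?_) (not_lt.1 fun hlt => ?_)
  · have h1 : ∀ᶠ t in 𝓝[>] x, T t < Q (F x) ∧ t ∈ Ioo x b :=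
      ((hTx.eventually (gt_mem_nhds hlt)).filter_mono nhdsWithin_le_nhds).and
        (Ioo_mem_nhdsGT hx.2)
    obtain ⟨t, ht, htI⟩ := h1.exists
    have htI' : t ∈ Ioo a b := ⟨hx.1.trans htI.1, htI.2⟩
    have h2 := monotone_cdf ν ht.le
    rw [h t htI', hQx] at h2
    exact absurd (hF hxI (Ioo_subset_Icc_self htI') htI.1) h2.not_gt
  · have h1 : ∀ᶠ t in 𝓝[<] x, Q (F x) < T t ∧ t ∈ Ioo a x :=
      ((hTx.eventually (lt_mem_nhds hlt)).filter_mono nhdsWithin_le_nhds).and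
        (Ioo_mem_nhdsLT hx.1)
    obtain ⟨t, ht, htI⟩ := h1.exists
    have htI' : t ∈ Ioo a b := ⟨htI.1, htI.2.trans hx.2⟩
    have h2 := monotone_cdf ν ht.le
    rw [h t htI', hQx] at h2
    exact absurd (hF (Ioo_subset_Icc_self htI') hxI htI.2) h2.not_gt

/-- A differentiable optimal map is `Q ∘ F`, everywhere in the open interval. -/
theorem comp_cdf_eq_optimal [IsProbabilityMeasure ν] (hQ : IsQuantile a b ν Q) (hab : a < b)
    [NullSingletonClass ν]
    (hν : ν (Icc a b)ᶜ = 0) (hf : IsSmoothDensity a b f) (hpos : ∀ x ∈ Icc a b, 0 < f x)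
    {T : ℝ → ℝ} (hTo : IsOptimalTransportMap (densityMeasure a b f) ν T)
    (hT : ContinuousOn T (Ioo a b)) {x : ℝ} (hx : x ∈ Ioo a b) :
    Q (cdf (densityMeasure a b f) x) = T x := by
  set μ := densityMeasure a b f with hμ
  have := hf.isProbabilityMeasure
  have hF := hf.strictMonoOn_cdf hpos
  refine hQ.comp_cdf_eq hF (fun x _ => cdf_mem_Icc μ x) hT ?_ hx
  have hae := hf.ae_restrict_of_ae hpos (hTo.cdf_comp_ae_eq hab.le
    (densityMeasure_compl_Icc a b f) hν hF (hQ.monotone_comp_cdf μ)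
    (fun x => (hQ _ (cdf_mem_Icc μ x)).1) (fun x => (hQ _ (cdf_mem_Icc μ x)).2))
  -- Both sides are continuous on the open interval, so the equality holds everywhere there.
  refine Measure.eqOn_open_of_ae_eq
    (ae_restrict_of_ae_restrict_of_subset Ioo_subset_Icc_self hae) isOpen_Ioo ?_ ?_
  · exact (continuous_cdf ν).comp_continuousOn hT
  · exact (continuous_cdf μ).continuousOn

/-- The derivative of the quantile function of the target, read off from an optimal map. -/
theorem hasDerivAt [IsProbabilityMeasure ν] (hQ : IsQuantile a b ν Q) (hab : a < b)
    [NullSingletonClass ν]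
    (hν : ν (Icc a b)ᶜ = 0) (hf : IsSmoothDensity a b f) (hpos : ∀ x ∈ Icc a b, 0 < f x)
    {T : ℝ → ℝ} (hTo : IsOptimalTransportMap (densityMeasure a b f) ν T)
    (hT : DifferentiableOn ℝ T (Ioo a b)) {x : ℝ} (hx : x ∈ Ioo a b) :
    HasDerivAt Q (deriv T x / f x) (cdf (densityMeasure a b f) x) := by
  set F := cdf (densityMeasure a b f)
  have hF := hf.strictMonoOn_cdf hpos
  set g := Function.invFunOn F (Ioo a b) with hg
  have hgF : LeftInvOn g F (Ioo a b) := (hF.injOn.mono Ioo_subset_Icc_self).leftInvOn_invFunOn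
  have hgd : HasDerivAt g (f x)⁻¹ (F x) :=
    ((hf.hasStrictDerivAt_cdf hx).to_local_left_inverse (hpos x (Ioo_subset_Icc_self hx)).ne'
      (Filter.eventually_of_mem (isOpen_Ioo.mem_nhds hx) hgF)).hasDerivAt
  have hTd : HasDerivAt T (deriv T x) (g (F x)) := by
    rw [hgF hx]
    exact (hT.differentiableAt (isOpen_Ioo.mem_nhds hx)).hasDerivAt
  -- Near `F x` the quantile function is `T ∘ F⁻¹`.
  refine (hTd.comp (F x) hgd).congr_of_eventuallyEq ?_
  filter_upwards [isOpen_Ioo.mem_nhds (hf.cdf_mem_Ioo hpos hx)] with u hu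
  obtain ⟨t, ht, rfl⟩ := hf.exists_cdf_eq_of_mem_Ioo hab hu
  rw [Function.comp_apply]
  change Q (F t) = T (g (F t))
  rw [hgF ht]
  exact hQ.comp_cdf_eq_optimal hab hν hf hpos hTo hT.continuousOn ht

/-- If a differentiable optimal map from a positive density has bounded derivative, then the
quantile function of the target is differentiable on `(0, 1)` with bounded derivative. -/
theorem differentiableAt_and_bound [IsProbabilityMeasure ν] (hQ : IsQuantile a b ν Q) (hab : a < b)
    [NullSingletonClass ν]
    (hν : ν (Icc a b)ᶜ = 0) (hf : IsSmoothDensity a b f) (hpos : ∀ x ∈ Icc a b, 0 < f x)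
    {T : ℝ → ℝ} (hTo : IsOptimalTransportMap (densityMeasure a b f) ν T)
    (hT : DifferentiableOn ℝ T (Ioo a b)) (hTb : ∃ M : ℝ, ∀ x ∈ Ioo a b, |deriv T x| ≤ M) :
    ∃ L : ℝ, ∀ u ∈ Ioo (0 : ℝ) 1, DifferentiableAt ℝ Q u ∧ |deriv Q u| ≤ L := by
  obtain ⟨M, hM⟩ := hTb
  obtain ⟨x₀, hx₀, hmin⟩ := isCompact_Icc.exists_isMinOn (nonempty_Icc.2 hab.le)
    hf.smooth.continuousOn
  refine ⟨M / f x₀, fun u hu => ?_⟩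
  obtain ⟨t, ht, rfl⟩ := hf.exists_cdf_eq_of_mem_Ioo hab hu
  have h := hQ.hasDerivAt hab hν hf hpos hTo hT ht
  refine ⟨h.differentiableAt, ?_⟩
  have htI := Ioo_subset_Icc_self ht
  rw [h.deriv, abs_div, abs_of_pos (hpos t htI)]
  exact div_le_div₀ ((abs_nonneg _).trans (hM t ht)) (hM t ht) (hpos x₀ hx₀) (hmin htI)

theorem intervalIntegrable (hQ : IsQuantile a b ν Q) : IntervalIntegrable Q volume 0 1 := by
  refine MonotoneOn.intervalIntegrable ?_
  rw [uIcc_of_le zero_le_one]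
  exact hQ.monotoneOn

theorem intervalIntegrable_sq (hQ : IsQuantile a b ν Q) :
    IntervalIntegrable (fun u => Q u ^ 2) volume 0 1 := by
  have h := hQ.intervalIntegrable
  rw [intervalIntegrable_iff_integrableOn_Ioc_of_le zero_le_one] at h ⊢
  refine Integrable.of_bound (h.aestronglyMeasurable.pow 2) ((|a| + |b|) ^ 2) ?_
  filter_upwards [ae_restrict_mem measurableSet_Ioc] with u hu
  have hQu := (hQ u (Ioc_subset_Icc_self hu)).1
  rw [Real.norm_eq_abs, abs_pow]
  refine pow_le_pow_left₀ (abs_nonneg _) (abs_le.2 ⟨?_, ?_⟩) 2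
  · linarith [hQu.1, neg_abs_le a, abs_nonneg b]
  · linarith [hQu.2, le_abs_self b, abs_nonneg a]

end IsQuantile

theorem continuousOn_primitive_zero_one {q : ℝ → ℝ} (hq : IntervalIntegrable q volume 0 1) :
    ContinuousOn (fun u => ∫ t in (0 : ℝ)..u, q t) (Icc 0 1) := by
  have h := intervalIntegral.continuousOn_primitive_interval (μ := volume) (f := q)
    (a := 0) (b := 1)
  rw [uIcc_of_le zero_le_one] at h
  refine h ?_
  rwa [integrableOn_Icc_iff_integrableOn_Ioc, ← intervalIntegrable_iff_integrableOn_Ioc_of_le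
    zero_le_one]

theorem hasDerivAt_primitive_zero_one {q : ℝ → ℝ} (hq : IntervalIntegrable q volume 0 1)
    (hqc : ContinuousOn q (Ioo 0 1)) {u : ℝ} (hu : u ∈ Ioo (0 : ℝ) 1) :
    HasDerivAt (fun u => ∫ t in (0 : ℝ)..u, q t) (q u) u :=
  intervalIntegral.integral_hasDerivAt_right
    (hq.mono_set (by
      rw [uIcc_of_le hu.1.le, uIcc_of_le zero_le_one]
      exact Icc_subset_Icc_right hu.2.le))
    (hqc.stronglyMeasurableAtFilter isOpen_Ioo u hu) (hqc.continuousAt (isOpen_Ioo.mem_nhds hu))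

/-- With `F` the distribution function of the source and `H` the primitive of the quantile
function `Q` of the target, half the squared Wasserstein distance is, up to a constant that does
not depend on the source, the integral of `H(F(x)) - x F(x)`. Indeed the integrand
`½ (x - Q(F))² F' + x F - H(F)` is the derivative of `½ x² F - x H(F) + ½ ∫₀^F Q²`. -/
theorem half_W₂_sq_eq [IsProbabilityMeasure ν] (hQ : IsQuantile a b ν Q) (hab : a < b)
    (hν : ν (Icc a b)ᶜ = 0) (hf : IsSmoothDensity a b f) (hpos : ∀ x ∈ Icc a b, 0 < f x)
    (hQc : ContinuousOn Q (Ioo 0 1)) :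
    1 / 2 * W₂ (densityMeasure a b f) ν ^ 2 =
      (1 / 2 * b ^ 2 - b * (∫ t in (0 : ℝ)..1, Q t) + 1 / 2 * ∫ t in (0 : ℝ)..1, Q t ^ 2) +
      ∫ x in Icc a b, ((∫ t in (0 : ℝ)..(∫ y in a..x, f y), Q t) - x * ∫ y in a..x, f y) := by
  set μ := densityMeasure a b f with hμdef
  have := hf.isProbabilityMeasure
  have hμ : μ (Icc a b)ᶜ = 0 := densityMeasure_compl_Icc a b f
  have hF := hf.strictMonoOn_cdf hpos
  have hSm := hQ.monotone_comp_cdf μ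
  have hSI : ∀ x, Q (cdf μ x) ∈ Icc a b := fun x => (hQ _ (cdf_mem_Icc μ x)).1
  have hFc : Continuous (cdf μ) := continuous_cdf μ
  set H : ℝ → ℝ := fun u => ∫ t in (0 : ℝ)..u, Q t with hH
  set K : ℝ → ℝ := fun u => ∫ t in (0 : ℝ)..u, Q t ^ 2 with hK
  have hHF : ContinuousOn (fun x => H (cdf μ x)) (Icc a b) :=
    (continuousOn_primitive_zero_one hQ.intervalIntegrable).comp hFc.continuousOn
      fun x _ => cdf_mem_Icc μ x
  have hKF : ContinuousOn (fun x => K (cdf μ x)) (Icc a b) :=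
    (continuousOn_primitive_zero_one hQ.intervalIntegrable_sq).comp hFc.continuousOn
      fun x _ => cdf_mem_Icc μ x
  have hcost : IntegrableOn (fun x => f x * (x - Q (cdf μ x)) ^ 2) (Icc a b) := by
    refine hf.integrableOn.mul_bdd (c := (b - a) ^ 2) ?_ ?_
    · exact ((measurable_id.sub hSm.measurable).pow_const 2).aestronglyMeasurable
    · filter_upwards [ae_restrict_mem measurableSet_Icc] with x hx
      rw [Real.norm_eq_abs, abs_pow]
      refine pow_le_pow_left₀ (abs_nonneg _) ?_ 2
      rw [abs_le]
      constructor <;> linarith [hx.1, hx.2, (hSI x).1, (hSI x).2]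
  have hrest : IntegrableOn (fun x => H (cdf μ x) - x * cdf μ x) (Icc a b) :=
    (hHF.sub (by fun_prop)).integrableOn_compact isCompact_Icc
  have hftc : ∫ x in a..b, (1 / 2 * (f x * (x - Q (cdf μ x)) ^ 2) - (H (cdf μ x) - x * cdf μ x))
      = (1 / 2 * b ^ 2 * cdf μ b - b * H (cdf μ b) + 1 / 2 * K (cdf μ b))
        - (1 / 2 * a ^ 2 * cdf μ a - a * H (cdf μ a) + 1 / 2 * K (cdf μ a)) := by
    refine intervalIntegral.integral_eq_sub_of_hasDerivAt_of_le
      (f := fun x => 1 / 2 * x ^ 2 * cdf μ x - x * H (cdf μ x) + 1 / 2 * K (cdf μ x))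
      hab.le ?_ (fun x hx => ?_) ?_
    · have hFc' := hFc.continuousOn (s := Icc a b)
      exact (((continuousOn_const.mul (continuousOn_id.pow 2)).mul hFc').sub
        (continuousOn_id.mul hHF)).add (continuousOn_const.mul hKF)
    · have h1 : HasDerivAt (cdf μ) (f x) x := (hf.hasStrictDerivAt_cdf hx).hasDerivAt
      have hu := hf.cdf_mem_Ioo hpos hx
      have h2 : HasDerivAt (fun x => H (cdf μ x)) (Q (cdf μ x) * f x) x :=
        (hasDerivAt_primitive_zero_one hQ.intervalIntegrable hQc hu).comp x h1
      have h3 : HasDerivAt (fun x => K (cdf μ x)) (Q (cdf μ x) ^ 2 * f x) x :=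
        (hasDerivAt_primitive_zero_one hQ.intervalIntegrable_sq (hQc.pow 2) hu).comp x h1
      have h4 := (((((hasDerivAt_id x).pow 2).const_mul (1 / 2)).mul h1).sub
        ((hasDerivAt_id x).mul h2)).add (h3.const_mul (1 / 2))
      convert! h4 using 1
      simp
      ring
    · rw [intervalIntegrable_iff_integrableOn_Ioc_of_le hab.le,
        ← integrableOn_Icc_iff_integrableOn_Ioc]
      exact (hcost.const_mul _).sub hrest
  rw [cdf_left_eq_zero hμ, cdf_right_eq_one hμ, intervalIntegral.integral_of_le hab.le,
    ← integral_Icc_eq_integral_Ioc, integral_sub (hcost.const_mul _) hrest,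
    integral_const_mul] at hftc
  have hH0 : H 0 = 0 := intervalIntegral.integral_same
  have hK0 : K 0 = 0 := intervalIntegral.integral_same
  rw [hH0, hK0] at hftc
  have hconv : ∫ x in Icc a b, (H (∫ y in a..x, f y) - x * ∫ y in a..x, f y)
      = ∫ x in Icc a b, (H (cdf μ x) - x * cdf μ x) :=
    setIntegral_congr_fun measurableSet_Icc fun x hx => by
      simp only [hμdef, hf.cdf_eq hx]
  rw [W₂_sq_eq_integral hab.le hμ hν hF hSm hSI fun x => (hQ _ (cdf_mem_Icc μ x)).2,
    hf.integral_densityMeasure, hconv]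
  change _ = (1 / 2 * b ^ 2 - b * H 1 + 1 / 2 * K 1) + _
  linarith

end Quantile

/-! ### Measurability and domination of parameter derivatives -/

section ParameterDerivatives

variable {α : Type*} [MeasurableSpace α] {μ : Measure α} {d : ℕ}
  {Y : Type*} [NormedAddCommGroup Y] [NormedSpace ℝ Y]

theorem aestronglyMeasurable_fderiv_apply {g : α → EuclideanSpace ℝ (Fin d) → Y}
    {U : Set (EuclideanSpace ℝ (Fin d))} (hU : IsOpen U) {θ : EuclideanSpace ℝ (Fin d)}
    (hθ : θ ∈ U) (hg : ∀ θ ∈ U, AEStronglyMeasurable (fun x => g x θ) μ)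
    (hd : ∀ᵐ x ∂μ, DifferentiableAt ℝ (g x) θ) (v : EuclideanSpace ℝ (Fin d)) :
    AEStronglyMeasurable (fun x => fderiv ℝ (g x) θ v) μ := by
  have hlim : Tendsto (fun n : ℕ => θ + ((n : ℝ))⁻¹ • v) atTop (𝓝 θ) := by
    have h : Tendsto (fun n : ℕ => ((n : ℝ))⁻¹) atTop (𝓝 0) :=
      tendsto_inv_atTop_zero.comp tendsto_natCast_atTop_atTop
    simpa using tendsto_const_nhds.add (h.smul_const v)
  -- The derivative is a limit of difference quotients; the shift by `N` keeps all of the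
  -- parameters in `U`.
  obtain ⟨N, hN⟩ := eventually_atTop.1 (hlim.eventually (hU.mem_nhds hθ))
  have hc : Tendsto (fun n : ℕ => ‖((n + N : ℕ) : ℝ)‖) atTop atTop :=
    tendsto_norm_atTop_atTop.comp
      (tendsto_natCast_atTop_atTop.comp (tendsto_add_atTop_nat N))
  refine aestronglyMeasurable_of_tendsto_ae atTop
    (f := fun (n : ℕ) x => ((n + N : ℕ) : ℝ) • (g x (θ + (((n + N : ℕ) : ℝ))⁻¹ • v) - g x θ))
    (fun n => ((hg _ (hN _ (Nat.le_add_left N n))).sub (hg _ hθ)).const_smul _) ?_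
  filter_upwards [hd] with x hx using hx.hasFDerivAt.lim v hc

theorem clm_eq_sum_smulRight (A : EuclideanSpace ℝ (Fin d) →L[ℝ] Y) :
    A = ∑ i, (EuclideanSpace.proj i : EuclideanSpace ℝ (Fin d) →L[ℝ] ℝ).smulRight
      (A (EuclideanSpace.single i 1)) := by
  refine ContinuousLinearMap.ext fun v => ?_
  conv_lhs => rw [← (EuclideanSpace.basisFun (Fin d) ℝ).sum_repr v]
  simp [map_sum]

theorem norm_clm_le_sum (A : EuclideanSpace ℝ (Fin d) →L[ℝ] Y) :
    ‖A‖ ≤ ∑ i, ‖A (EuclideanSpace.single i 1)‖ := by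
  refine A.opNorm_le_bound (Finset.sum_nonneg fun i _ => norm_nonneg _) fun v => ?_
  conv_lhs => rw [clm_eq_sum_smulRight A]
  rw [_root_.sum_apply, Finset.sum_mul]
  refine (norm_sum_le _ _).trans (Finset.sum_le_sum fun i _ => ?_)
  rw [ContinuousLinearMap.smulRight_apply, norm_smul, mul_comm]
  exact mul_le_mul_of_nonneg_left (PiLp.norm_apply_le v i) (norm_nonneg _)

theorem aestronglyMeasurable_clm {A : α → EuclideanSpace ℝ (Fin d) →L[ℝ] Y}
    (h : ∀ i, AEStronglyMeasurable (fun x => A x (EuclideanSpace.single i 1)) μ) :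
    AEStronglyMeasurable A μ := by
  have h1 : A = fun x => ∑ i, ContinuousLinearMap.smulRightL ℝ (EuclideanSpace ℝ (Fin d)) Y
      (EuclideanSpace.proj i : EuclideanSpace ℝ (Fin d) →L[ℝ] ℝ)
      (A x (EuclideanSpace.single i 1)) := by
    funext x
    exact clm_eq_sum_smulRight (A x)
  rw [h1]
  exact Finset.aestronglyMeasurable_fun_sum _ fun i _ =>
    (ContinuousLinearMap.continuous _).comp_aestronglyMeasurable (h i)

theorem aestronglyMeasurable_fderiv {g : α → EuclideanSpace ℝ (Fin d) → Y}
    {U : Set (EuclideanSpace ℝ (Fin d))} (hU : IsOpen U) {θ : EuclideanSpace ℝ (Fin d)}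
    (hθ : θ ∈ U) (hg : ∀ θ ∈ U, AEStronglyMeasurable (fun x => g x θ) μ)
    (hd : ∀ᵐ x ∂μ, DifferentiableAt ℝ (g x) θ) :
    AEStronglyMeasurable (fun x => fderiv ℝ (g x) θ) μ :=
  aestronglyMeasurable_clm fun i =>
    aestronglyMeasurable_fderiv_apply hU hθ hg hd (EuclideanSpace.single i 1)

/-- A supremum over an open set of parameters whose (lower) integral is finite yields an
integrable majorant. By continuity the supremum may be taken over a countable dense set of
parameters, which makes it measurable. -/
theorem exists_integrable_majorant {E : Type*} [TopologicalSpace E]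
    [SecondCountableTopology E] {g : α → E → ℝ} {U : Set E} (hU : IsOpen U)
    (hg : ∀ θ ∈ U, AEStronglyMeasurable (fun x => g x θ) μ)
    (hc : ∀ᵐ x ∂μ, ContinuousOn (g x) U)
    (hfin : ∫⁻ x, ⨆ θ ∈ U, ENNReal.ofReal |g x θ| ∂μ < ⊤) :
    ∃ m : α → ℝ, Integrable m μ ∧ ∀ᵐ x ∂μ, ∀ θ ∈ U, |g x θ| ≤ m x := by
  obtain ⟨D, hDc, hDd⟩ := TopologicalSpace.exists_countable_dense E
  set M : α → ℝ≥0∞ := fun x => ⨆ θ ∈ U ∩ D, ENNReal.ofReal |g x θ| with hM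
  have hMm : AEMeasurable M μ := AEMeasurable.biSup _ (hDc.mono inter_subset_right) fun θ hθ =>
    ((hg θ hθ.1).norm.aemeasurable).ennreal_ofReal
  have hMfin : ∫⁻ x, M x ∂μ ≠ ⊤ :=
    ((lintegral_mono fun x => biSup_mono fun θ hθ => hθ.1).trans_lt hfin).ne
  refine ⟨fun x => (M x).toReal, integrable_toReal_of_lintegral_ne_top hMm hMfin, ?_⟩
  filter_upwards [hc, ae_lt_top' hMm hMfin] with x hx hxM θ hθ
  have hcl : θ ∈ closure (U ∩ D) := hDd.open_subset_closure_inter hU hθ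
  have : (𝓝[U ∩ D] θ).NeBot := mem_closure_iff_nhdsWithin_neBot.1 hcl
  have ht : Tendsto (fun θ' => |g x θ'|) (𝓝[U ∩ D] θ) (𝓝 |g x θ|) :=
    ((hx θ hθ).mono inter_subset_left).abs
  refine le_of_tendsto ht ?_
  filter_upwards [self_mem_nhdsWithin] with θ' hθ'
  rw [← ENNReal.ofReal_le_iff_le_toReal hxM.ne]
  exact le_iSup₂ (f := fun θ (_ : θ ∈ U ∩ D) => ENNReal.ofReal |g x θ|) θ' hθ'

end ParameterDerivatives

/-! ### Regularity of the distribution functions of a statistical model -/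

section Model

variable {d : ℕ} {a b : ℝ} {Θ : Set (EuclideanSpace ℝ (Fin d))}
  {ρ : ℝ → EuclideanSpace ℝ (Fin d) → ℝ}

theorem ae_restrict_Icc_mem_Ioo (a b : ℝ) :
    ∀ᵐ x ∂volume.restrict (Icc a b), x ∈ Ioo a b := by
  rw [← restrict_Ioo_eq_restrict_Icc]
  exact ae_restrict_mem measurableSet_Ioo

namespace IsStatisticalModel

theorem continuousOn_modelCDF (hρ : IsStatisticalModel a b Θ ρ) {θ : EuclideanSpace ℝ (Fin d)}
    (hθ : θ ∈ Θ) : ContinuousOn (fun x => modelCDF a ρ x θ) (Icc a b) := by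
  have := (hρ.density θ hθ).isProbabilityMeasure
  exact (continuous_cdf _).continuousOn.congr fun x hx => ((hρ.density θ hθ).cdf_eq hx).symm

theorem modelCDF_mem_Ioo (hρ : IsStatisticalModel a b Θ ρ) {θ : EuclideanSpace ℝ (Fin d)}
    (hθ : θ ∈ Θ) {x : ℝ} (hx : x ∈ Ioo a b) : modelCDF a ρ x θ ∈ Ioo (0 : ℝ) 1 := by
  have h := (hρ.density θ hθ).cdf_mem_Ioo (hρ.pos θ hθ) hx
  rwa [(hρ.density θ hθ).cdf_eq (Ioo_subset_Icc_self hx)] at h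

theorem modelCDF_mem_Icc (hρ : IsStatisticalModel a b Θ ρ) {θ : EuclideanSpace ℝ (Fin d)}
    (hθ : θ ∈ Θ) {x : ℝ} (hx : x ∈ Icc a b) : modelCDF a ρ x θ ∈ Icc (0 : ℝ) 1 := by
  rw [modelCDF, ← (hρ.density θ hθ).cdf_eq hx]
  exact cdf_mem_Icc _ _

theorem hasFDerivAt_modelCDF (hρ : IsStatisticalModel a b Θ ρ) (hΘ : IsOpen Θ)
    {θ : EuclideanSpace ℝ (Fin d)} (hθ : θ ∈ Θ) {x : ℝ} (hx : x ∈ Icc a b) :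
    HasFDerivAt (modelCDF a ρ x) (fderiv ℝ (modelCDF a ρ x) θ) θ :=
  (((hρ.contDiffOn_cdf x hx).differentiableOn (by norm_num)).differentiableAt
    (hΘ.mem_nhds hθ)).hasFDerivAt

theorem contDiffOn_fderiv_modelCDF (hρ : IsStatisticalModel a b Θ ρ) (hΘ : IsOpen Θ)
    {x : ℝ} (hx : x ∈ Icc a b) : ContDiffOn ℝ 1 (fderiv ℝ (modelCDF a ρ x)) Θ :=
  (hρ.contDiffOn_cdf x hx).fderiv_of_isOpen hΘ (by norm_num)

theorem hasFDerivAt_fderiv_modelCDF (hρ : IsStatisticalModel a b Θ ρ) (hΘ : IsOpen Θ)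
    {θ : EuclideanSpace ℝ (Fin d)} (hθ : θ ∈ Θ) {x : ℝ} (hx : x ∈ Icc a b) :
    HasFDerivAt (fderiv ℝ (modelCDF a ρ x)) (fderiv ℝ (fderiv ℝ (modelCDF a ρ x)) θ) θ :=
  (((hρ.contDiffOn_fderiv_modelCDF hΘ hx).differentiableOn (by norm_num)).differentiableAt
    (hΘ.mem_nhds hθ)).hasFDerivAt

theorem pderiv_pderiv_modelCDF (hρ : IsStatisticalModel a b Θ ρ) (hΘ : IsOpen Θ)
    {θ : EuclideanSpace ℝ (Fin d)} (hθ : θ ∈ Θ) {x : ℝ} (hx : x ∈ Icc a b) (i j : Fin d) :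
    pderiv i (pderiv j (modelCDF a ρ x)) θ = hessian (modelCDF a ρ x) θ i j := by
  have h := (hρ.hasFDerivAt_fderiv_modelCDF hΘ hθ hx).clm_apply
    (hasFDerivAt_const (EuclideanSpace.single j (1 : ℝ)) θ)
  change fderiv ℝ (fun θ => fderiv ℝ (modelCDF a ρ x) θ (EuclideanSpace.single j 1)) θ _ = _
  rw [h.fderiv]
  simp [hessian]

theorem aestronglyMeasurable_modelCDF (hρ : IsStatisticalModel a b Θ ρ)
    {θ : EuclideanSpace ℝ (Fin d)} (hθ : θ ∈ Θ) :
    AEStronglyMeasurable (fun x => modelCDF a ρ x θ) (volume.restrict (Icc a b)) :=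
  (hρ.continuousOn_modelCDF hθ).aestronglyMeasurable measurableSet_Icc

theorem aestronglyMeasurable_fderiv_modelCDF (hρ : IsStatisticalModel a b Θ ρ) (hΘ : IsOpen Θ)
    {θ : EuclideanSpace ℝ (Fin d)} (hθ : θ ∈ Θ) :
    AEStronglyMeasurable (fun x => fderiv ℝ (modelCDF a ρ x) θ) (volume.restrict (Icc a b)) := by
  refine aestronglyMeasurable_fderiv hΘ hθ (fun θ hθ => hρ.aestronglyMeasurable_modelCDF hθ) ?_
  filter_upwards [ae_restrict_mem measurableSet_Icc] with x hx
    using (hρ.hasFDerivAt_modelCDF hΘ hθ hx).differentiableAt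

theorem aestronglyMeasurable_fderiv_fderiv_modelCDF (hρ : IsStatisticalModel a b Θ ρ)
    (hΘ : IsOpen Θ) {θ : EuclideanSpace ℝ (Fin d)} (hθ : θ ∈ Θ) :
    AEStronglyMeasurable (fun x => fderiv ℝ (fderiv ℝ (modelCDF a ρ x)) θ)
      (volume.restrict (Icc a b)) := by
  refine aestronglyMeasurable_fderiv hΘ hθ
    (fun θ hθ => hρ.aestronglyMeasurable_fderiv_modelCDF hΘ hθ) ?_
  filter_upwards [ae_restrict_mem measurableSet_Icc] with x hx
    using (hρ.hasFDerivAt_fderiv_modelCDF hΘ hθ hx).differentiableAt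

theorem aestronglyMeasurable_density (hρ : IsStatisticalModel a b Θ ρ)
    {θ : EuclideanSpace ℝ (Fin d)} (hθ : θ ∈ Θ) :
    AEStronglyMeasurable (fun x => ρ x θ) (volume.restrict (Icc a b)) :=
  (hρ.density θ hθ).integrableOn.aestronglyMeasurable

theorem differentiableAt_density (hρ : IsStatisticalModel a b Θ ρ) (hΘ : IsOpen Θ)
    {θ : EuclideanSpace ℝ (Fin d)} (hθ : θ ∈ Θ) {x : ℝ} (hx : x ∈ Icc a b) :
    DifferentiableAt ℝ (ρ x) θ :=
  ((hρ.contDiffOn_density x hx).differentiableOn (by norm_num)).differentiableAt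
    (hΘ.mem_nhds hθ)

/-- If the parameter derivatives of the density have an integrable majorant on a convex open set
of parameters, then the gradients of the distribution functions are uniformly bounded there:
`F(x, ·)` is Lipschitz with the integral of the majorant as constant. -/
theorem norm_fderiv_modelCDF_le (hρ : IsStatisticalModel a b Θ ρ) (hΘ : IsOpen Θ)
    {U : Set (EuclideanSpace ℝ (Fin d))} (hU : IsOpen U) (hUc : Convex ℝ U) (hUΘ : U ⊆ Θ)
    {m : ℝ → ℝ} (hm : IntegrableOn m (Icc a b))
    (hb : ∀ᵐ x ∂volume.restrict (Icc a b), ∀ θ ∈ U, ‖fderiv ℝ (ρ x) θ‖ ≤ m x)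
    {θ : EuclideanSpace ℝ (Fin d)} (hθ : θ ∈ U) {x : ℝ} (hx : x ∈ Icc a b) :
    ‖fderiv ℝ (modelCDF a ρ x) θ‖ ≤ ∫ y in Icc a b, |m y| := by
  set C := ∫ y in Icc a b, |m y| with hC
  have hC0 : 0 ≤ C := integral_nonneg fun y => abs_nonneg _
  refine norm_fderiv_le_of_lip' ℝ hC0 ?_
  filter_upwards [hU.mem_nhds hθ] with θ' hθ'
  have ha : a ∈ Icc a b := ⟨le_rfl, hx.1.trans hx.2⟩
  have hi := (hρ.density θ (hUΘ hθ)).intervalIntegrable ha hx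
  have hi' := (hρ.density θ' (hUΘ hθ')).intervalIntegrable ha hx
  rw [modelCDF, modelCDF, ← intervalIntegral.integral_sub hi' hi,
    intervalIntegral.integral_of_le hx.1, hC, ← integral_mul_const]
  have hmi : IntegrableOn (fun y => |m y| * ‖θ' - θ‖) (Icc a b) := hm.abs.mul_const _
  have hsub : Ioc a x ⊆ Icc a b := fun t ht => ⟨ht.1.le, ht.2.trans hx.2⟩
  refine (norm_integral_le_of_norm_le (hmi.mono_set hsub) ?_).trans
    (setIntegral_mono_set hmi (Eventually.of_forall fun y => by positivity)
      (Eventually.of_forall hsub))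
  filter_upwards [ae_restrict_of_ae_restrict_of_subset hsub hb,
    ae_restrict_of_ae_restrict_of_subset hsub (ae_restrict_mem measurableSet_Icc)] with y hy hyI
  exact hUc.norm_image_sub_le_of_norm_fderiv_le (𝕜 := ℝ)
    (fun z hz => hρ.differentiableAt_density hΘ (hUΘ hz) hyI)
    (fun z hz => (hy z hz).trans (le_abs_self _)) hθ hθ'

/-- Near every parameter the gradients of the distribution functions are uniformly bounded, and
their second derivatives have an integrable majorant. -/
theorem exists_bounds (hρ : IsStatisticalModel a b Θ ρ) (hΘ : IsOpen Θ)
    (hDom : DominationAssumption a b Θ ρ) {θ₀ : EuclideanSpace ℝ (Fin d)} (hθ₀ : θ₀ ∈ Θ) :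
    ∃ U ∈ 𝓝 θ₀, U ⊆ Θ ∧ ∃ (K : ℝ) (m : ℝ → ℝ), IntegrableOn m (Icc a b) ∧
      (∀ x ∈ Icc a b, ∀ θ ∈ U, ‖fderiv ℝ (modelCDF a ρ x) θ‖ ≤ K) ∧
      ∀ᵐ x ∂volume.restrict (Icc a b), ∀ θ ∈ U,
        ‖fderiv ℝ (fderiv ℝ (modelCDF a ρ x)) θ‖ ≤ m x := by
  obtain ⟨N, hN, hNΘ, hNdom⟩ := hDom θ₀ hθ₀
  obtain ⟨ε, hε, hεN⟩ := Metric.mem_nhds_iff.1 hN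
  set U := Metric.ball θ₀ ε with hUdef
  have hU : IsOpen U := Metric.isOpen_ball
  have hUΘ : U ⊆ Θ := hεN.trans hNΘ
  have hIcc := ae_restrict_mem (μ := (volume : Measure ℝ)) (measurableSet_Icc (a := a) (b := b))
  have hF2 : ∀ i j : Fin d, ∃ m : ℝ → ℝ, IntegrableOn m (Icc a b) ∧
      ∀ᵐ x ∂volume.restrict (Icc a b), ∀ θ ∈ U,
        |pderiv i (pderiv j (modelCDF a ρ x)) θ| ≤ m x := by
    intro i j
    refine exists_integrable_majorant (g := fun x => pderiv i (pderiv j (modelCDF a ρ x))) hU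
      (fun θ hθ => ?_) ?_
      ((lintegral_mono fun x => biSup_mono fun θ hθ => hεN hθ).trans_lt (hNdom i j).1)
    · have h := hρ.aestronglyMeasurable_fderiv_fderiv_modelCDF hΘ (hUΘ hθ)
      refine ((h.apply_continuousLinearMap (EuclideanSpace.single i 1)).apply_continuousLinearMap
        (EuclideanSpace.single j 1)).congr ?_
      filter_upwards [hIcc] with x hx
      exact (hρ.pderiv_pderiv_modelCDF hΘ (hUΘ hθ) hx i j).symm
    · filter_upwards [hIcc] with x hx
      have hc := (hρ.contDiffOn_fderiv_modelCDF hΘ hx).continuousOn_fderiv_of_isOpen hΘ le_rfl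
      exact ((((hc.clm_apply continuousOn_const).clm_apply continuousOn_const).congr
        fun θ hθ => hρ.pderiv_pderiv_modelCDF hΘ hθ hx i j)).mono hUΘ
  have hρ1 : ∀ i : Fin d, ∃ m : ℝ → ℝ, IntegrableOn m (Icc a b) ∧
      ∀ᵐ x ∂volume.restrict (Icc a b), ∀ θ ∈ U, |pderiv i (ρ x) θ| ≤ m x := by
    intro i
    refine exists_integrable_majorant (g := fun x => pderiv i (ρ x)) hU (fun θ hθ => ?_) ?_
      ((lintegral_mono fun x => biSup_mono fun θ hθ => hεN hθ).trans_lt (hNdom i i).2.1)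
    · refine aestronglyMeasurable_fderiv_apply hΘ (hUΘ hθ)
        (fun θ hθ => hρ.aestronglyMeasurable_density hθ) ?_ _
      filter_upwards [hIcc] with x hx using hρ.differentiableAt_density hΘ (hUΘ hθ) hx
    · filter_upwards [hIcc] with x hx
      exact (((hρ.contDiffOn_density x hx).continuousOn_fderiv_of_isOpen hΘ le_rfl).clm_apply
        continuousOn_const).mono hUΘ
  choose m₁ hm₁i hm₁ using hρ1
  choose m₂ hm₂i hm₂ using hF2
  refine ⟨U, hU.mem_nhds (Metric.mem_ball_self hε), hUΘ, _, fun x => ∑ i, ∑ j, m₂ i j x,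
    integrable_finsetSum _ fun i _ => integrable_finsetSum _ fun j _ => hm₂i i j,
    fun x hx θ hθ => hρ.norm_fderiv_modelCDF_le hΘ hU (convex_ball _ _) hUΘ
      (m := fun x => ∑ i, m₁ i x) (integrable_finsetSum _ fun i _ => hm₁i i) ?_ hθ hx, ?_⟩
  · filter_upwards [ae_all_iff.2 hm₁] with x hx θ hθ
    exact (norm_clm_le_sum _).trans (Finset.sum_le_sum fun i _ => hx i θ hθ)
  · filter_upwards [ae_all_iff.2 fun i => ae_all_iff.2 (hm₂ i), hIcc] with x hx hxI θ hθ
    refine (norm_clm_le_sum _).trans (Finset.sum_le_sum fun i _ => (norm_clm_le_sum _).trans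
      (Finset.sum_le_sum fun j _ => ?_))
    have h := hx i j θ hθ
    rwa [hρ.pderiv_pderiv_modelCDF hΘ (hUΘ hθ) hxI i j] at h

end IsStatisticalModel

end Model

/-! ### Differentiation under the integral sign -/

section Differentiation

variable {d : ℕ} {a b : ℝ} {Θ : Set (EuclideanSpace ℝ (Fin d))}
  {ρ : ℝ → EuclideanSpace ℝ (Fin d) → ℝ} {H Q : ℝ → ℝ}

theorem abs_sub_le_of_mem_Icc {s t : ℝ} (hs : s ∈ Icc a b) (ht : t ∈ Icc a b) :
    |s - t| ≤ b - a :=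
  abs_le.2 ⟨by linarith [hs.1, ht.2], by linarith [hs.2, ht.1]⟩

theorem aestronglyMeasurable_comp_modelCDF (hρ : IsStatisticalModel a b Θ ρ)
    (hQc : ContinuousOn Q (Ioo 0 1)) {θ : EuclideanSpace ℝ (Fin d)} (hθ : θ ∈ Θ) :
    AEStronglyMeasurable (fun x => Q (modelCDF a ρ x θ)) (volume.restrict (Icc a b)) := by
  rw [← restrict_Ioo_eq_restrict_Icc]
  exact (hQc.comp ((hρ.continuousOn_modelCDF hθ).mono Ioo_subset_Icc_self)
    fun x hx => hρ.modelCDF_mem_Ioo hθ hx).aestronglyMeasurable measurableSet_Ioo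

/-- The gradient of `∫ (H(F) - x F) dx`, where `H' = Q`. -/
theorem hasFDerivAt_integral_primitive (hρ : IsStatisticalModel a b Θ ρ) (hΘ : IsOpen Θ)
    (hDom : DominationAssumption a b Θ ρ) (hHc : ContinuousOn H (Icc 0 1))
    (hH : ∀ u ∈ Ioo (0 : ℝ) 1, HasDerivAt H (Q u) u) (hQc : ContinuousOn Q (Ioo 0 1))
    (hQI : ∀ u ∈ Ioo (0 : ℝ) 1, Q u ∈ Icc a b)
    {θ₀ : EuclideanSpace ℝ (Fin d)} (hθ₀ : θ₀ ∈ Θ) :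
    HasFDerivAt (fun θ => ∫ x in Icc a b, (H (modelCDF a ρ x θ) - x * modelCDF a ρ x θ))
      (∫ x in Icc a b, (Q (modelCDF a ρ x θ₀) - x) • fderiv ℝ (modelCDF a ρ x) θ₀) θ₀ := by
  obtain ⟨U, hU, hUΘ, K, m, -, hK, -⟩ := hρ.exists_bounds hΘ hDom hθ₀
  have hcont : ∀ θ ∈ Θ, ContinuousOn (fun x => H (modelCDF a ρ x θ) - x * modelCDF a ρ x θ)
      (Icc a b) := fun θ hθ =>
    (hHc.comp (hρ.continuousOn_modelCDF hθ) fun x hx => hρ.modelCDF_mem_Icc hθ hx).sub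
      (continuousOn_id.mul (hρ.continuousOn_modelCDF hθ))
  refine hasFDerivAt_integral_of_dominated_of_fderiv_le (bound := fun _ => (b - a) * K) hU
    (F' := fun θ x => (Q (modelCDF a ρ x θ) - x) • fderiv ℝ (modelCDF a ρ x) θ)
    ?_ ((hcont θ₀ hθ₀).integrableOn_compact isCompact_Icc) ?_ ?_ (integrable_const _) ?_
  · filter_upwards [hΘ.mem_nhds hθ₀] with θ hθ
    exact (hcont θ hθ).aestronglyMeasurable measurableSet_Icc
  · exact ((aestronglyMeasurable_comp_modelCDF hρ hQc hθ₀).sub aestronglyMeasurable_id).smul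
      (hρ.aestronglyMeasurable_fderiv_modelCDF hΘ hθ₀)
  · filter_upwards [ae_restrict_Icc_mem_Ioo a b] with x hx θ hθ
    have hxI := Ioo_subset_Icc_self hx
    rw [norm_smul]
    exact mul_le_mul (abs_sub_le_of_mem_Icc (hQI _ (hρ.modelCDF_mem_Ioo (hUΘ hθ) hx)) hxI)
      (hK x hxI θ hθ) (norm_nonneg _) (by linarith [hx.1, hx.2])
  · filter_upwards [ae_restrict_Icc_mem_Ioo a b] with x hx θ hθ
    have h1 := hρ.hasFDerivAt_modelCDF hΘ (hUΘ hθ) (Ioo_subset_Icc_self hx)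
    have h2 := ((hH _ (hρ.modelCDF_mem_Ioo (hUΘ hθ) hx)).comp_hasFDerivAt θ h1).sub
      (h1.const_mul x)
    rw [sub_smul]
    exact h2

/-- The product rule under the integral sign, for a bounded factor with bounded derivative and a
bounded factor whose derivative has an integrable majorant. The derivative is described by its
values, which take the form of integrals in the target space `Y`. -/
theorem differentiableAt_integral_smul {E Y : Type*} [NormedAddCommGroup E] [NormedSpace ℝ E]
    [NormedAddCommGroup Y] [NormedSpace ℝ Y] [CompleteSpace Y]
    {μ : Measure ℝ} [IsFiniteMeasure μ] {q : ℝ → E → ℝ} {G : ℝ → E → Y} {θ₀ : E} {U : Set E}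
    (hU : U ∈ 𝓝 θ₀) {c C K : ℝ} {m : ℝ → ℝ} (hm : Integrable m μ)
    (hqm : ∀ θ ∈ U, AEStronglyMeasurable (fun x => q x θ) μ)
    (hqm' : AEStronglyMeasurable (fun x => fderiv ℝ (q x) θ₀) μ)
    (hGm : ∀ θ ∈ U, AEStronglyMeasurable (fun x => G x θ) μ)
    (hGm' : AEStronglyMeasurable (fun x => fderiv ℝ (G x) θ₀) μ)
    (hq : ∀ᵐ x ∂μ, ∀ θ ∈ U,
      DifferentiableAt ℝ (q x) θ ∧ |q x θ| ≤ c ∧ ‖fderiv ℝ (q x) θ‖ ≤ C)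
    (hG : ∀ᵐ x ∂μ, ∀ θ ∈ U,
      DifferentiableAt ℝ (G x) θ ∧ ‖G x θ‖ ≤ K ∧ ‖fderiv ℝ (G x) θ‖ ≤ m x) :
    DifferentiableAt ℝ (fun θ => ∫ x, q x θ • G x θ ∂μ) θ₀ ∧
    ∀ v, Integrable (fun x => q x θ₀ • fderiv ℝ (G x) θ₀ v + fderiv ℝ (q x) θ₀ v • G x θ₀) μ ∧
      fderiv ℝ (fun θ => ∫ x, q x θ • G x θ ∂μ) θ₀ v =
      ∫ x, (q x θ₀ • fderiv ℝ (G x) θ₀ v + fderiv ℝ (q x) θ₀ v • G x θ₀) ∂μ := by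
  set D : E → ℝ → E →L[ℝ] Y := fun θ x =>
    q x θ • fderiv ℝ (G x) θ + (fderiv ℝ (q x) θ).smulRight (G x θ) with hD
  have hθ₀ := mem_of_mem_nhds hU
  have hDm : AEStronglyMeasurable (D θ₀) μ :=
    ((hqm θ₀ hθ₀).smul hGm').add
      ((ContinuousLinearMap.smulRightL ℝ E Y).aestronglyMeasurable_comp₂ hqm' (hGm θ₀ hθ₀))
  have hbound : ∀ᵐ x ∂μ, ∀ θ ∈ U, ‖D θ x‖ ≤ c * m x + C * K := by
    filter_upwards [hq, hG] with x hqx hGx θ hθ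
    obtain ⟨-, h1, h2⟩ := hqx θ hθ
    obtain ⟨-, h3, h4⟩ := hGx θ hθ
    refine (norm_add_le _ _).trans (add_le_add ?_ ?_)
    · rw [norm_smul]
      exact mul_le_mul h1 h4 (norm_nonneg _) ((abs_nonneg _).trans h1)
    · rw [ContinuousLinearMap.norm_smulRight_apply]
      exact mul_le_mul h2 h3 (norm_nonneg _) ((norm_nonneg _).trans h2)
  have hbi : Integrable (fun x => c * m x + C * K) μ := (hm.const_mul _).add (integrable_const _)
  have hDi : Integrable (D θ₀) μ := hbi.mono' hDm (hbound.mono fun x hx => hx θ₀ hθ₀)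
  have key : HasFDerivAt (fun θ => ∫ x, q x θ • G x θ ∂μ) (∫ x, D θ₀ x ∂μ) θ₀ := by
    refine hasFDerivAt_integral_of_dominated_of_fderiv_le hU ?_ ?_ hDm hbound hbi ?_
    · filter_upwards [hU] with θ hθ using (hqm θ hθ).smul (hGm θ hθ)
    · refine Integrable.of_bound ((hqm θ₀ hθ₀).smul (hGm θ₀ hθ₀)) (c * K) ?_
      filter_upwards [hq, hG] with x hqx hGx
      obtain ⟨-, h1, -⟩ := hqx θ₀ hθ₀
      obtain ⟨-, h3, -⟩ := hGx θ₀ hθ₀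
      rw [norm_smul]
      exact mul_le_mul h1 h3 (norm_nonneg _) ((abs_nonneg _).trans h1)
    · filter_upwards [hq, hG] with x hqx hGx θ hθ
      exact (hqx θ hθ).1.hasFDerivAt.smul (hGx θ hθ).1.hasFDerivAt
  refine ⟨key.differentiableAt, fun v => ⟨hDi.apply_continuousLinearMap v, ?_⟩⟩
  rw [key.fderiv, ContinuousLinearMap.integral_apply hDi]
  rfl

/-- The derivative of the gradient `∫ (Q(F) - x) ∇F dx`. -/
theorem differentiableAt_integral_gradient (hρ : IsStatisticalModel a b Θ ρ) (hΘ : IsOpen Θ)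
    (hDom : DominationAssumption a b Θ ρ) {L : ℝ}
    (hQ : ∀ u ∈ Ioo (0 : ℝ) 1, DifferentiableAt ℝ Q u ∧ |deriv Q u| ≤ L)
    (hQI : ∀ u ∈ Ioo (0 : ℝ) 1, Q u ∈ Icc a b)
    {θ₀ : EuclideanSpace ℝ (Fin d)} (hθ₀ : θ₀ ∈ Θ) :
    DifferentiableAt ℝ
      (fun θ => ∫ x in Icc a b, (Q (modelCDF a ρ x θ) - x) • fderiv ℝ (modelCDF a ρ x) θ) θ₀ ∧
    ∀ i j : Fin d,
      IntegrableOn (fun x => (Q (modelCDF a ρ x θ₀) - x) * hessian (modelCDF a ρ x) θ₀ i j)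
        (Icc a b) ∧
      IntegrableOn (fun x => deriv Q (modelCDF a ρ x θ₀) *
        (pderiv i (modelCDF a ρ x) θ₀ * pderiv j (modelCDF a ρ x) θ₀)) (Icc a b) ∧
      fderiv ℝ (fun θ => ∫ x in Icc a b, (Q (modelCDF a ρ x θ) - x) •
          fderiv ℝ (modelCDF a ρ x) θ) θ₀ (EuclideanSpace.single i 1) (EuclideanSpace.single j 1) =
        (∫ x in Icc a b, (Q (modelCDF a ρ x θ₀) - x) * hessian (modelCDF a ρ x) θ₀ i j) +
        ∫ x in Icc a b, deriv Q (modelCDF a ρ x θ₀) *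
          (pderiv i (modelCDF a ρ x) θ₀ * pderiv j (modelCDF a ρ x) θ₀) := by
  obtain ⟨U, hU, hUΘ, K, m, hm, hK, hmb⟩ := hρ.exists_bounds hΘ hDom hθ₀
  have hθU := mem_of_mem_nhds hU
  have hQc : ContinuousOn Q (Ioo 0 1) := fun u hu => (hQ u hu).1.continuousAt.continuousWithinAt
  have hIoo := ae_restrict_Icc_mem_Ioo a b
  have hF1m := fun θ (hθ : θ ∈ Θ) => hρ.aestronglyMeasurable_fderiv_modelCDF hΘ hθ
  have hqm : ∀ θ ∈ U, AEStronglyMeasurable (fun x => Q (modelCDF a ρ x θ) - x)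
      (volume.restrict (Icc a b)) := fun θ hθ =>
    (aestronglyMeasurable_comp_modelCDF hρ hQc (hUΘ hθ)).sub aestronglyMeasurable_id
  have hQ'm : AEStronglyMeasurable (fun x => deriv Q (modelCDF a ρ x θ₀))
      (volume.restrict (Icc a b)) :=
    ((measurable_deriv Q).comp_aemeasurable
      (hρ.aestronglyMeasurable_modelCDF hθ₀).aemeasurable).aestronglyMeasurable
  have hqd : ∀ x ∈ Ioo a b, ∀ θ ∈ U, HasFDerivAt (fun θ => Q (modelCDF a ρ x θ) - x)
      (deriv Q (modelCDF a ρ x θ) • fderiv ℝ (modelCDF a ρ x) θ) θ := fun x hx θ hθ =>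
    ((hQ _ (hρ.modelCDF_mem_Ioo (hUΘ hθ) hx)).1.hasDerivAt.comp_hasFDerivAt θ
      (hρ.hasFDerivAt_modelCDF hΘ (hUΘ hθ) (Ioo_subset_Icc_self hx))).sub_const x
  have hsub : ∀ x ∈ Ioo a b, ∀ θ ∈ U, |Q (modelCDF a ρ x θ) - x| ≤ b - a := fun x hx θ hθ =>
    abs_sub_le_of_mem_Icc (hQI _ (hρ.modelCDF_mem_Ioo (hUΘ hθ) hx)) (Ioo_subset_Icc_self hx)
  obtain ⟨hdiff, hval⟩ := differentiableAt_integral_smul (μ := volume.restrict (Icc a b)) hU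
    (q := fun x θ => Q (modelCDF a ρ x θ) - x) (G := fun x => fderiv ℝ (modelCDF a ρ x))
    (c := b - a) (C := L * K) (K := K) hm hqm
    ((hQ'm.smul (hF1m θ₀ hθ₀)).congr (by
      filter_upwards [hIoo] with x hx using (hqd x hx θ₀ hθU).fderiv.symm))
    (fun θ hθ => hF1m θ (hUΘ hθ)) (hρ.aestronglyMeasurable_fderiv_fderiv_modelCDF hΘ hθ₀)
    (by
      filter_upwards [hIoo] with x hx θ hθ
      have hu := (hQ _ (hρ.modelCDF_mem_Ioo (hUΘ hθ) hx)).2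
      refine ⟨(hqd x hx θ hθ).differentiableAt, hsub x hx θ hθ, ?_⟩
      rw [(hqd x hx θ hθ).fderiv, norm_smul]
      exact mul_le_mul hu (hK x (Ioo_subset_Icc_self hx) θ hθ) (norm_nonneg _)
        ((abs_nonneg _).trans hu))
    (by
      filter_upwards [hIoo, hmb] with x hx hmx θ hθ
      have hxI := Ioo_subset_Icc_self hx
      exact ⟨(hρ.hasFDerivAt_fderiv_modelCDF hΘ (hUΘ hθ) hxI).differentiableAt, hK x hxI θ hθ,
        hmx θ hθ⟩)
  refine ⟨hdiff, fun i j => ?_⟩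
  have hpm : ∀ i : Fin d, AEStronglyMeasurable (fun x => pderiv i (modelCDF a ρ x) θ₀)
      (volume.restrict (Icc a b)) := fun i => (hF1m θ₀ hθ₀).apply_continuousLinearMap _
  have hpb : ∀ i : Fin d, ∀ x ∈ Icc a b, |pderiv i (modelCDF a ρ x) θ₀| ≤ K := fun i x hx => by
    have h := (fderiv ℝ (modelCDF a ρ x) θ₀).le_of_opNorm_le (hK x hx θ₀ hθU)
      (EuclideanSpace.single i 1)
    simpa [pderiv] using h
  have hsecond : IntegrableOn (fun x => deriv Q (modelCDF a ρ x θ₀) *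
      (pderiv i (modelCDF a ρ x) θ₀ * pderiv j (modelCDF a ρ x) θ₀)) (Icc a b) := by
    refine Integrable.of_bound (hQ'm.mul ((hpm i).mul (hpm j))) (L * (K * K)) ?_
    filter_upwards [hIoo] with x hx
    have hxI := Ioo_subset_Icc_self hx
    have hu := (hQ _ (hρ.modelCDF_mem_Ioo hθ₀ hx)).2
    rw [Real.norm_eq_abs, abs_mul, abs_mul]
    exact mul_le_mul hu (mul_le_mul (hpb i x hxI) (hpb j x hxI) (abs_nonneg _)
      ((abs_nonneg _).trans (hpb i x hxI))) (by positivity) ((abs_nonneg _).trans hu)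
  obtain ⟨hint, heq⟩ := hval (EuclideanSpace.single i 1)
  have hint' := hint.apply_continuousLinearMap (EuclideanSpace.single j 1)
  have hae : (fun x => ((Q (modelCDF a ρ x θ₀) - x) •
        fderiv ℝ (fderiv ℝ (modelCDF a ρ x)) θ₀ (EuclideanSpace.single i 1) +
      fderiv ℝ (fun θ => Q (modelCDF a ρ x θ) - x) θ₀ (EuclideanSpace.single i 1) •
        fderiv ℝ (modelCDF a ρ x) θ₀) (EuclideanSpace.single j 1))
      =ᵐ[volume.restrict (Icc a b)] fun x =>
        (Q (modelCDF a ρ x θ₀) - x) * hessian (modelCDF a ρ x) θ₀ i j +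
        deriv Q (modelCDF a ρ x θ₀) *
          (pderiv i (modelCDF a ρ x) θ₀ * pderiv j (modelCDF a ρ x) θ₀) := by
    filter_upwards [hIoo] with x hx
    rw [(hqd x hx θ₀ hθU).fderiv]
    simp only [_root_.add_apply, _root_.smul_apply, smul_eq_mul, hessian,
      pderiv, Matrix.of_apply, mul_assoc]
  have hfirst : IntegrableOn
      (fun x => (Q (modelCDF a ρ x θ₀) - x) * hessian (modelCDF a ρ x) θ₀ i j) (Icc a b) := by
    refine ((hint'.congr hae).sub hsecond).congr (Eventually.of_forall fun x => ?_)
    simp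
  refine ⟨hfirst, hsecond, ?_⟩
  rw [heq, ContinuousLinearMap.integral_apply hint, integral_congr_ae hae,
    integral_add hfirst hsecond]

end Differentiation

end WassersteinHessian

/-! ### The Hessian of the Wasserstein loss -/

theorem mainTheorem1 {d : ℕ} (a b : ℝ) (hab : a < b)
    (Θ : Set (EuclideanSpace ℝ (Fin d))) (hΘ : IsOpen Θ)
    (ρ : ℝ → EuclideanSpace ℝ (Fin d) → ℝ) (hρ : IsStatisticalModel a b Θ ρ)
    (hElliptic : EllipticAssumption a b Θ ρ) (hDom : DominationAssumption a b Θ ρ)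
    (ρstar : ℝ → ℝ) (hρstar : IsSmoothDensity a b ρstar)
    (T : ℝ → EuclideanSpace ℝ (Fin d) → ℝ)
    (hT : ∀ θ ∈ Θ, IsOptimalTransportMap (densityMeasure a b fun x => ρ x θ)
      (densityMeasure a b ρstar) fun x => T x θ)
    (hTdiff : ∀ θ ∈ Θ, DifferentiableOn ℝ (fun x => T x θ) (Set.Ioo a b))
    (hTbdd : ∀ θ ∈ Θ, ∃ M : ℝ, ∀ x ∈ Set.Ioo a b, |deriv (fun y => T y θ) x| ≤ M) :
    DifferentiableOn ℝ (wassersteinLoss a b ρ ρstar) Θ ∧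
    ∀ θ ∈ Θ,
      DifferentiableAt ℝ (fderiv ℝ (wassersteinLoss a b ρ ρstar)) θ ∧
      ∀ i j : Fin d,
        MeasureTheory.IntegrableOn
          (fun x => (T x θ - x) * hessian (modelCDF a ρ x) θ i j) (Set.Icc a b) ∧
        MeasureTheory.IntegrableOn
          (fun x => deriv (fun y => T y θ) x / ρ x θ *
            (pderiv i (modelCDF a ρ x) θ * pderiv j (modelCDF a ρ x) θ)) (Set.Icc a b) ∧
        hessian (wassersteinLoss a b ρ ρstar) θ i j =
          (∫ x in Set.Icc a b, (T x θ - x) * hessian (modelCDF a ρ x) θ i j) +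
          ∫ x in Set.Icc a b, deriv (fun y => T y θ) x / ρ x θ *
            (pderiv i (modelCDF a ρ x) θ * pderiv j (modelCDF a ρ x) θ) := by
  have hν := densityMeasure_compl_Icc a b ρstar
  have := hρstar.isProbabilityMeasure
  obtain ⟨Q, hQ⟩ := exists_isQuantile hab.le hν
  have hQI : ∀ u ∈ Ioo (0 : ℝ) 1, Q u ∈ Icc a b := fun u hu => (hQ u (Ioo_subset_Icc_self hu)).1
  have hgrad : ∀ θ ∈ Θ, HasFDerivAt (wassersteinLoss a b ρ ρstar)
      (∫ x in Icc a b, (Q (modelCDF a ρ x θ) - x) • fderiv ℝ (modelCDF a ρ x) θ) θ := by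
    intro θ hθ
    obtain ⟨L, hL⟩ := hQ.differentiableAt_and_bound hab hν (hρ.density θ hθ) (hρ.pos θ hθ)
      (hT θ hθ) (hTdiff θ hθ) (hTbdd θ hθ)
    have hQc : ContinuousOn Q (Ioo 0 1) := fun u hu =>
      (hL u hu).1.continuousAt.continuousWithinAt
    have h := hasFDerivAt_integral_primitive hρ hΘ hDom
      (continuousOn_primitive_zero_one hQ.intervalIntegrable)
      (fun u hu => hasDerivAt_primitive_zero_one hQ.intervalIntegrable hQc hu) hQc hQI hθ
    refine (h.const_add (1 / 2 * b ^ 2 - b * (∫ t in (0 : ℝ)..1, Q t)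
      + 1 / 2 * ∫ t in (0 : ℝ)..1, Q t ^ 2)).congr_of_eventuallyEq ?_
    filter_upwards [hΘ.mem_nhds hθ] with θ' hθ'
    exact half_W₂_sq_eq hQ hab hν (hρ.density θ' hθ') (hρ.pos θ' hθ') hQc
  refine ⟨fun θ hθ => (hgrad θ hθ).differentiableAt.differentiableWithinAt, fun θ hθ => ?_⟩
  obtain ⟨L, hL⟩ := hQ.differentiableAt_and_bound hab hν (hρ.density θ hθ) (hρ.pos θ hθ)
    (hT θ hθ) (hTdiff θ hθ) (hTbdd θ hθ)
  obtain ⟨hdiff, hhess⟩ := differentiableAt_integral_gradient hρ hΘ hDom hL hQI hθ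
  have heq : fderiv ℝ (wassersteinLoss a b ρ ρstar) =ᶠ[𝓝 θ] fun θ =>
      ∫ x in Icc a b, (Q (modelCDF a ρ x θ) - x) • fderiv ℝ (modelCDF a ρ x) θ := by
    filter_upwards [hΘ.mem_nhds hθ] with θ' hθ' using (hgrad θ' hθ').fderiv
  refine ⟨hdiff.congr_of_eventuallyEq heq, fun i j => ?_⟩
  obtain ⟨h1, h2, h3⟩ := hhess i j
  have hae1 : (fun x => (Q (modelCDF a ρ x θ) - x) * hessian (modelCDF a ρ x) θ i j)
      =ᵐ[volume.restrict (Icc a b)] fun x => (T x θ - x) * hessian (modelCDF a ρ x) θ i j := by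
    filter_upwards [ae_restrict_Icc_mem_Ioo a b] with x hx
    have h := hQ.comp_cdf_eq_optimal hab hν (hρ.density θ hθ) (hρ.pos θ hθ) (hT θ hθ)
      (hTdiff θ hθ).continuousOn hx
    rw [(hρ.density θ hθ).cdf_eq (Ioo_subset_Icc_self hx)] at h
    rw [modelCDF, h]
  have hae2 : (fun x => deriv Q (modelCDF a ρ x θ) *
        (pderiv i (modelCDF a ρ x) θ * pderiv j (modelCDF a ρ x) θ))
      =ᵐ[volume.restrict (Icc a b)] fun x => deriv (fun y => T y θ) x / ρ x θ *
        (pderiv i (modelCDF a ρ x) θ * pderiv j (modelCDF a ρ x) θ) := by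
    filter_upwards [ae_restrict_Icc_mem_Ioo a b] with x hx
    have h := (hQ.hasDerivAt hab hν (hρ.density θ hθ) (hρ.pos θ hθ) (hT θ hθ)
      (hTdiff θ hθ) hx).deriv
    rw [(hρ.density θ hθ).cdf_eq (Ioo_subset_Icc_self hx)] at h
    rw [← h]
    rfl
  refine ⟨h1.congr hae1, h2.congr hae2, ?_⟩
  rw [← integral_congr_ae hae1, ← integral_congr_ae hae2, ← h3, hessian, Matrix.of_apply,
    heq.fderiv_eq]
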